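/- **Proposition 3.3.** Let $\rho:\mathbb R\to\mathbb R$ be a nonnegative, smooth, radial (even) function with compact support, not identically zero, and set $\rho_n(x)=n\rho(nx)$. Let $T>0$, $M\in\mathbb R$, and let $\{f_n\}_{n\ge 1}$ be a sequence of (classes of) real-valued measurable functions on $(0,T)\times\mathbb R$ such that, for all $n\ge1$, $$\|f_n\|_{L^\infty((0,T),L^2(\mathbb R))}\le M,$$ $$n^2\int_0^T\int_{\mathbb R}\int_{\mathbb R}\rho_n(x-y)\,\bigl(f_n(t,x)-f_n(t,y)\bigr)^2\,dx\,dy\,dt\le M,$$ $$\|\partial_t f_n\|_{L^2((0,T),H^{-1}(\mathbb R))}\le M.$$ Here $H^1(\mathbb R)$ carries the norm $(\|u\|_{L^2}^2+\|u'\|_{L^2}^2)^{1/2}$, $H^{-1}(\mathbb R)$ is its dual with the dual norm, and $\partial_t f_n$ is the weak time derivative: the last condition means that there is $g_n\in L^2((0,T),H^{-1}(\mathbb R))$ of norm at most $M$ with $$\int_0^T\varphi'(t)\int_{\mathbb R}f_n(t,x)v(x)\,dx\,dt=-\int_0^T\varphi(t)\,\langle g_n(t),v\rangle\,dt\qquad\text{for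 all }\varphi\in C_c^\infty((0,T)),\ v\in H^1(\mathbb R).$$ Then there exist a function $f\in L^2((0,T),H^1(\mathbb R))$ and a subsequence $\{f_{n_k}\}_k$ such that $f_{n_k}\to f$ in $L^2_{loc}((0,T)\times\mathbb R)$, that is, $f_{n_k}\to f$ in $L^2(K)$ for every compact set $K\subset(0,T)\times\mathbb R$. -/

import Mathlib

open MeasureTheory Set Filter Topology
open scoped ENNReal ContDiff

/-- Smooth real test functions on `ℝ` with compact support contained in `U`. -/
structure IsTestOn (U : Set ℝ) (φ : ℝ → ℝ) : Prop where
  smooth : ContDiff ℝ ∞ φ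
  compact : HasCompactSupport φ
  subset : tsupport φ ⊆ U

/-- A smooth compactly supported function is integrable against every `L²` function. -/
theorem integrable_lp_mul_test (u : Lp ℝ 2 (volume : Measure ℝ)) {φ : ℝ → ℝ}
    (hc : Continuous φ) (hs : HasCompactSupport φ) :
    Integrable (fun x => u x * φ x) volume :=
  (Lp.memLp u).integrable_mul
    (hc.memLp_of_hasCompactSupport hs : MemLp φ 2 (volume : Measure ℝ))

/-- The Sobolev space `H¹(ℝ)` (real valued): pairs `(u, u')` in `L²(ℝ) × L²(ℝ)` such that `u'` is
the weak derivative of `u`, that is, `∫ u φ' = - ∫ u' φ` for all test functions `φ`. The norm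
inherited from the `ℓ²` product is `‖u‖² + ‖u'‖²` under the square root. -/
noncomputable def SobolevH1 :
    Submodule ℝ (WithLp 2 (Lp ℝ 2 (volume : Measure ℝ) × Lp ℝ 2 (volume : Measure ℝ))) where
  carrier := {p | ∀ φ : ℝ → ℝ, IsTestOn univ φ →
    ∫ x, p.fst x * deriv φ x = - ∫ x, p.snd x * φ x}
  zero_mem' := by
    intro φ _
    have h := Lp.coeFn_zero ℝ 2 (volume : Measure ℝ)
    have h1 : ∫ x, (0 : Lp ℝ 2 (volume : Measure ℝ)) x * deriv φ x = 0 := by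
      rw [integral_congr_ae (g := fun _ => (0 : ℝ)) (by filter_upwards [h] with x hx; rw [hx]; simp)]
      simp
    have h2 : ∫ x, (0 : Lp ℝ 2 (volume : Measure ℝ)) x * φ x = 0 := by
      rw [integral_congr_ae (g := fun _ => (0 : ℝ)) (by filter_upwards [h] with x hx; rw [hx]; simp)]
      simp
    simp only [WithLp.zero_fst, WithLp.zero_snd, h1, h2, neg_zero]
  add_mem' := by
    intro p q hp hq φ hφ
    have key : ∀ (u v : Lp ℝ 2 (volume : Measure ℝ)) (ψ : ℝ → ℝ), Continuous ψ →
        HasCompactSupport ψ →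
        ∫ x, (u + v) x * ψ x = (∫ x, u x * ψ x) + ∫ x, v x * ψ x := by
      intro u v ψ hc hs
      rw [← integral_add (integrable_lp_mul_test u hc hs) (integrable_lp_mul_test v hc hs)]
      refine integral_congr_ae ?_
      filter_upwards [Lp.coeFn_add u v] with x hx
      rw [hx, Pi.add_apply, add_mul]
    have hd : Continuous (deriv φ) := hφ.smooth.continuous_deriv (by simp)
    rw [WithLp.add_fst, WithLp.add_snd, key _ _ _ hd hφ.compact.deriv,
      key _ _ _ hφ.smooth.continuous hφ.compact, hp φ hφ, hq φ hφ]
    ring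
  smul_mem' := by
    intro c p hp φ hφ
    have key : ∀ (u : Lp ℝ 2 (volume : Measure ℝ)) (ψ : ℝ → ℝ),
        ∫ x, (c • u) x * ψ x = c * ∫ x, u x * ψ x := by
      intro u ψ
      rw [← integral_const_mul]
      refine integral_congr_ae ?_
      filter_upwards [Lp.coeFn_smul c u] with x hx
      rw [hx, Pi.smul_apply, smul_eq_mul, mul_assoc]
    rw [WithLp.smul_fst, WithLp.smul_snd, key, key, hp φ hφ]
    ring

/-- The function underlying an element of `H¹(ℝ)`, as an element of `L²(ℝ)`. -/
noncomputable def SobolevH1.toL2 (v : SobolevH1) : Lp ℝ 2 (volume : Measure ℝ) :=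
  (v : WithLp 2 (Lp ℝ 2 (volume : Measure ℝ) × Lp ℝ 2 (volume : Measure ℝ))).fst

/-- `H⁻¹(ℝ)`, the dual of `H¹(ℝ)`, with the dual norm. -/
abbrev SobolevHneg1 : Type := StrongDual ℝ SobolevH1

/-- Lebesgue measure on the time interval `(0,T)`. -/
noncomputable def timeMeasure (T : ℝ) : Measure ℝ := volume.restrict (Ioo 0 T)

/-- (Classes of) measurable functions on `(0,T) × ℝ`, written `f t x`. -/
def MeasurableOnStrip (T : ℝ) (f : ℝ → ℝ → ℝ) : Prop :=
  AEStronglyMeasurable (fun p : ℝ × ℝ => f p.1 p.2) ((timeMeasure T).prod volume)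

/-- The norm of `f` in `L^∞((0,T), L²(ℝ))`. -/
noncomputable def normLinftyL2 (T : ℝ) (f : ℝ → ℝ → ℝ) : ℝ≥0∞ :=
  essSup (fun t => eLpNorm (f t) 2 volume) (timeMeasure T)

/-- `g : (0,T) → H⁻¹(ℝ)` is the weak time derivative of `f`: for every test function `φ` of time
`∫₀ᵀ φ'(t) f(t) dt = - ∫₀ᵀ φ(t) g(t) dt`, as an identity in `H⁻¹(ℝ)`, where `f(t)` acts on
`v ∈ H¹(ℝ)` by the `L²` pairing. -/
def IsWeakTimeDeriv (T : ℝ) (f : ℝ → ℝ → ℝ) (g : ℝ → SobolevHneg1) : Prop :=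
  ∀ φ : ℝ → ℝ, IsTestOn (Ioo 0 T) φ → ∀ v : SobolevH1,
    ∫ t, deriv φ t * (∫ x, f t x * SobolevH1.toL2 v x) ∂(timeMeasure T)
      = - ∫ t, φ t * g t v ∂(timeMeasure T)

/-- `∂ₜ f` belongs to the Bochner space `L²((0,T), H⁻¹(ℝ))`, with norm at most `M`. -/
def TimeDerivBound (T : ℝ) (f : ℝ → ℝ → ℝ) (M : ℝ≥0∞) : Prop :=
  ∃ g : ℝ → SobolevHneg1, MemLp g 2 (timeMeasure T) ∧ IsWeakTimeDeriv T f g ∧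
    eLpNorm g 2 (timeMeasure T) ≤ M

/-- `f` belongs to the Bochner space `L²((0,T), H¹(ℝ))`. -/
def MemL2H1 (T : ℝ) (f : ℝ → ℝ → ℝ) : Prop :=
  ∃ F : ℝ → SobolevH1, MemLp F 2 (timeMeasure T) ∧
    ∀ᵐ t ∂(timeMeasure T), f t =ᵐ[volume] SobolevH1.toL2 (F t)

/-- Convergence `f k → f` in `L²_loc((0,T) × ℝ)`: in `L²(K)` for all compact `K ⊆ (0,T) × ℝ`. -/
def TendstoL2loc (T : ℝ) (f : ℕ → ℝ → ℝ → ℝ) (f₀ : ℝ → ℝ → ℝ) : Prop :=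
  ∀ K : Set (ℝ × ℝ), IsCompact K → K ⊆ Ioo 0 T ×ˢ univ →
    Tendsto (fun k => eLpNorm (fun p : ℝ × ℝ => f k p.1 p.2 - f₀ p.1 p.2) 2 (volume.restrict K))
      atTop (𝓝 0)

/-- The rescaled kernel `ρₙ(x) = n ρ(n x)`. -/
noncomputable def rescaledKernel (ρ : ℝ → ℝ) (n : ℕ) (x : ℝ) : ℝ := n * ρ (n * x)

/-- The nonlocal energy `n² ∫₀ᵀ ∬ ρₙ(x - y) (f(t,x) - f(t,y))² dx dy dt`, with values in `[0,∞]`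
(the integrand is nonnegative for nonnegative `ρ`). -/
noncomputable def nonlocalEnergy (ρ : ℝ → ℝ) (T : ℝ) (n : ℕ) (f : ℝ → ℝ → ℝ) : ℝ≥0∞ :=
  (n : ℝ≥0∞) ^ 2 * ∫⁻ t in Ioo 0 T, (∫⁻ y, (∫⁻ x,
    ENNReal.ofReal (rescaledKernel ρ n (x - y) * (f t x - f t y) ^ 2) ∂volume) ∂volume)

/-! The energy bound controls increments of `f n` only over distances of order 1/n, so by itself it
says nothing about a fixed scale. Let S(h) be the L² norm over the strip of u(t, x + h) - u(t, x).
The triangle inequality gives S(2h) ≤ 2 S(h), so the energy of a single function does not increase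
when passing to a coarser dyadic scale (`lintegral_rescaledKernel_two_pow_mono`). Hence u_j, a
representative of `f (2 ^ j)`, satisfies the energy bound at every scale 2^m with m ≤ j. By Jensen's
inequality it is within O(2^(-m)) in L² of its spatial mollification by the normalized kernel at
scale 2^m, uniformly in j ≥ m.

At a fixed scale, the mollification at x is the pairing of u_j(t) with a translated test function,
which is an element of H¹; in time it therefore has a weak derivative bounded in L². For a weakly
convergent subsequence this forces convergence almost everywhere (`ae_exists_tendsto_mollify`), and
dominated convergence makes the mollifications Cauchy in L² of sets of finite measure. The functions
themselves are then Cauchy there, and their strong limit must be the weak limit w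
(`tendsto_eLpNorm_restrict_of_energy`).

For the regularity of w, Fatou's lemma in the shift variable yields one z ≠ 0 for which the
quotients 2^j (u_j(t, x + z/2^j) - u_j(t, x)) stay bounded in L² along a subsequence. In one space
dimension a single direction suffices: their weak limit is z ∂ₓw (`exists_weak_space_deriv`).
Separability then puts almost every time slice in H¹ (`memL2H1_of_weak_deriv`). -/

/-! ### Weak and strong convergence in L² -/

section WeakL2

variable {α : Type*} [MeasurableSpace α] {μ : Measure α}

/-- Weak convergence in `L²(μ)`, tested against all square integrable functions. -/
def WeakL2Tendsto (μ : Measure α) (u : ℕ → α → ℝ) (w : α → ℝ) : Prop :=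
  ∀ k : α → ℝ, MemLp k 2 μ → Tendsto (fun j => ∫ x, u j x * k x ∂μ) atTop (𝓝 (∫ x, w x * k x ∂μ))

theorem WeakL2Tendsto.comp {u : ℕ → α → ℝ} {w : α → ℝ} (h : WeakL2Tendsto μ u w)
    {φ : ℕ → ℕ} (hφ : StrictMono φ) : WeakL2Tendsto μ (fun j => u (φ j)) w :=
  fun k hk => (h k hk).comp hφ.tendsto_atTop

theorem MemLp.integrable_fun_mul {u k : α → ℝ} (hu : MemLp u 2 μ) (hk : MemLp k 2 μ) :
    Integrable (fun x => u x * k x) μ :=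
  hu.integrable_mul hk

theorem integral_sub_mul_of_memLp_two {u v k : α → ℝ} (hu : MemLp u 2 μ) (hv : MemLp v 2 μ)
    (hk : MemLp k 2 μ) :
    ∫ x, (u x - v x) * k x ∂μ = (∫ x, u x * k x ∂μ) - ∫ x, v x * k x ∂μ := by
  rw [← integral_sub (MemLp.integrable_fun_mul hu hk) (MemLp.integrable_fun_mul hv hk)]
  simp only [sub_mul]

theorem inner_toLp_eq_integral {u k : α → ℝ} (hu : MemLp u 2 μ) (hk : MemLp k 2 μ) :
    inner ℝ (hu.toLp u) (hk.toLp k) = ∫ x, u x * k x ∂μ := by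
  rw [L2.inner_def]
  refine integral_congr_ae ?_
  filter_upwards [hu.coeFn_toLp, hk.coeFn_toLp] with x h1 h2
  rw [h1, h2]
  simp [mul_comm]

/-- The Cauchy–Schwarz inequality for real functions. -/
theorem abs_integral_mul_le_eLpNorm_two {u k : α → ℝ} (hu : MemLp u 2 μ) (hk : MemLp k 2 μ) :
    |∫ x, u x * k x ∂μ| ≤ (eLpNorm u 2 μ).toReal * (eLpNorm k 2 μ).toReal := by
  rw [← inner_toLp_eq_integral hu hk, ← Lp.norm_toLp u hu, ← Lp.norm_toLp k hk]
  exact abs_real_inner_le_norm _ _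

theorem eLpNorm_two_sq (u : α → ℝ) : eLpNorm u 2 μ ^ 2 = ∫⁻ x, ‖u x‖ₑ ^ 2 ∂μ := by
  have h := eLpNorm_nnreal_pow_eq_lintegral (μ := μ) (f := u) (p := 2) two_ne_zero
  have h2 : ((2 : NNReal) : ℝ) = ((2 : ℕ) : ℝ) := by norm_num
  simp only [h2, ENNReal.rpow_natCast] at h
  exact_mod_cast h

/-- Bounded sequences in a separable `L²` space have weakly convergent subsequences. -/
theorem exists_subseq_weakL2Tendsto [MeasurableSpace.CountablyGenerated α] [SFinite μ]
    {u : ℕ → α → ℝ} (hu : ∀ j, MemLp (u j) 2 μ) {C : ℝ}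
    (hC : ∀ j, (eLpNorm (u j) 2 μ).toReal ≤ C) :
    ∃ φ : ℕ → ℕ, StrictMono φ ∧ ∃ w : α → ℝ, StronglyMeasurable w ∧ MemLp w 2 μ ∧
      WeakL2Tendsto μ (fun j => u (φ j)) w := by
  -- Needed for the separability of `Lp`, on which the sequential Banach–Alaoglu theorem below
  -- relies.
  have : Fact ((2 : ℝ≥0∞) ≠ ⊤) := ⟨by simp⟩
  let H := Lp ℝ 2 μ
  let U : ℕ → H := fun j => (hu j).toLp (u j)
  let W : ℕ → WeakDual ℝ H := fun j =>
    StrongDual.toWeakDual (InnerProductSpace.toDual ℝ H (U j))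
  have hW : ∀ j, W j ∈ WeakDual.toStrongDual ⁻¹' Metric.closedBall (0 : StrongDual ℝ H) C := by
    intro j
    simp only [mem_preimage, Metric.mem_closedBall, dist_zero_right]
    change ‖InnerProductSpace.toDual ℝ H (U j)‖ ≤ C
    rw [LinearIsometryEquiv.norm_map, Lp.norm_toLp]
    exact hC j
  obtain ⟨a, -, φ, hφ, ha⟩ := WeakDual.isSeqCompact_closedBall ℝ H 0 C hW
  let w : H := (InnerProductSpace.toDual ℝ H).symm (WeakDual.toStrongDual a)
  refine ⟨φ, hφ, w, Lp.stronglyMeasurable w, Lp.memLp w, fun k hk => ?_⟩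
  have h1 := ((WeakDual.eval_continuous (𝕜 := ℝ) (E := H) (hk.toLp k)).tendsto a).comp ha
  have h2 : ∀ j, W (φ j) (hk.toLp k) = ∫ x, u (φ j) x * k x ∂μ := fun j => by
    rw [← inner_toLp_eq_integral (hu (φ j)) hk]
    exact InnerProductSpace.toDual_apply_apply
  have h3 : a (hk.toLp k) = ∫ x, w x * k x ∂μ := by
    have : inner ℝ w (hk.toLp k) = a (hk.toLp k) := by
      rw [← InnerProductSpace.toDual_apply_apply (𝕜 := ℝ)]
      simp only [w, LinearIsometryEquiv.apply_symm_apply]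
      rfl
    rw [← this, ← inner_toLp_eq_integral (Lp.memLp w) hk, Lp.toLp_coeFn]
  rw [← h3]
  exact h1.congr h2

/-- The pairing of a weakly convergent bounded sequence with a strongly convergent one. -/
theorem WeakL2Tendsto.tendsto_integral_mul {u : ℕ → α → ℝ} {w : α → ℝ}
    (h : WeakL2Tendsto μ u w) (hu : ∀ j, MemLp (u j) 2 μ) {C : ℝ}
    (hC : ∀ j, (eLpNorm (u j) 2 μ).toReal ≤ C) {k : ℕ → α → ℝ} {k₀ : α → ℝ}
    (hk : ∀ j, MemLp (k j) 2 μ) (hk₀ : MemLp k₀ 2 μ)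
    (hlim : Tendsto (fun j => eLpNorm (fun x => k j x - k₀ x) 2 μ) atTop (𝓝 0)) :
    Tendsto (fun j => ∫ x, u j x * k j x ∂μ) atTop (𝓝 (∫ x, w x * k₀ x ∂μ)) := by
  have h0 : Tendsto (fun j => ∫ x, u j x * (k j x - k₀ x) ∂μ) atTop (𝓝 0) := by
    have hlim' : Tendsto (fun j => C * (eLpNorm (fun x => k j x - k₀ x) 2 μ).toReal) atTop (𝓝 0) := by
      simpa using ((ENNReal.tendsto_toReal ENNReal.zero_ne_top).comp hlim).const_mul C
    refine squeeze_zero_norm (fun j => ?_) hlim'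
    refine (abs_integral_mul_le_eLpNorm_two (hu j) ((hk j).sub hk₀)).trans ?_
    exact mul_le_mul_of_nonneg_right (hC j) ENNReal.toReal_nonneg
  have h1 := h0.add (h k₀ hk₀)
  rw [zero_add] at h1
  refine h1.congr fun j => ?_
  have e := integral_sub_mul_of_memLp_two (hk j) hk₀ (hu j)
  simp only [mul_comm _ (u j _)] at e
  rw [e, sub_add_cancel]

/-- A weakly convergent sequence which is Cauchy in `L²` of a set converges strongly there. -/
theorem WeakL2Tendsto.tendsto_eLpNorm_restrict {u : ℕ → α → ℝ} {w : α → ℝ}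
    (h : WeakL2Tendsto μ u w) (hu : ∀ j, MemLp (u j) 2 μ) (hw : MemLp w 2 μ)
    {s : Set α} (hs : MeasurableSet s)
    (hcau : ∀ ε > 0, ∃ N, ∀ i ≥ N, ∀ j ≥ N,
      (eLpNorm (fun x => u i x - u j x) 2 (μ.restrict s)).toReal ≤ ε) :
    Tendsto (fun j => eLpNorm (fun x => u j x - w x) 2 (μ.restrict s)) atTop (𝓝 0) := by
  have hmem : ∀ j, MemLp (fun x => u j x - w x) 2 (μ.restrict s) := fun j =>
    ((hu j).sub hw).restrict s
  rw [← ENNReal.tendsto_toReal_iff (fun j => (hmem j).eLpNorm_ne_top) ENNReal.zero_ne_top,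
    ENNReal.toReal_zero, Metric.tendsto_atTop]
  intro ε hε
  obtain ⟨N, hN⟩ := hcau (ε / 2) (by positivity)
  refine ⟨N, fun i hi => ?_⟩
  set d := fun x => u i x - w x with hd
  set A := (eLpNorm d 2 (μ.restrict s)).toReal with hA
  -- The test function is the error `d` itself, cut off to `s`: letting j → ∞ in ∫ (u i - u j) d
  -- over `s` gives A², while Cauchy–Schwarz bounds it by (ε/2) A.
  have hk : MemLp (s.indicator d) 2 μ := by
    rw [memLp_indicator_iff_restrict hs]; exact hmem i
  have hind : ∀ v : α → ℝ, ∫ x, v x * s.indicator d x ∂μ = ∫ x, v x * d x ∂(μ.restrict s) := by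
    intro v
    rw [← integral_indicator hs]
    refine integral_congr_ae (.of_forall fun x => ?_)
    by_cases hx : x ∈ s <;> simp [hx]
  have hlim : Tendsto (fun j => ∫ x, (u i x - u j x) * d x ∂(μ.restrict s)) atTop (𝓝 (A ^ 2)) := by
    have h1 := (h _ hk).const_sub (∫ x, u i x * s.indicator d x ∂μ)
    have e : (∫ x, u i x * s.indicator d x ∂μ) - (∫ x, w x * s.indicator d x ∂μ) = A ^ 2 := by
      rw [hind, hind, ← integral_sub_mul_of_memLp_two ((hu i).restrict s) (hw.restrict s) (hmem i),
        hA, ← Lp.norm_toLp d (hmem i), ← real_inner_self_eq_norm_sq, inner_toLp_eq_integral]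
    rw [e] at h1
    refine h1.congr fun j => ?_
    rw [hind, hind, ← integral_sub_mul_of_memLp_two ((hu i).restrict s) ((hu j).restrict s) (hmem i)]
  have hle : A ^ 2 ≤ ε / 2 * A := by
    refine le_of_tendsto hlim (eventually_atTop.2 ⟨N, fun j hj => ?_⟩)
    refine (le_abs_self _).trans ((abs_integral_mul_le_eLpNorm_two
      (((hu i).restrict s).sub ((hu j).restrict s)) (hmem i)).trans ?_)
    exact mul_le_mul_of_nonneg_right (hN i hi j hj) ENNReal.toReal_nonneg
  have hA0 : 0 ≤ A := ENNReal.toReal_nonneg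
  rw [Real.dist_eq, sub_zero, abs_of_nonneg hA0]
  nlinarith

/-- Dominated convergence in `L²`. -/
theorem tendsto_eLpNorm_two_of_dominated {u : ℕ → α → ℝ} {w g : α → ℝ}
    (hu : ∀ j, AEStronglyMeasurable (u j) μ) (hw : AEStronglyMeasurable w μ) (hg : MemLp g 2 μ)
    (hbound : ∀ j, ∀ᵐ x ∂μ, |u j x| ≤ g x)
    (hlim : ∀ᵐ x ∂μ, Tendsto (fun j => u j x) atTop (𝓝 (w x))) :
    Tendsto (fun j => eLpNorm (fun x => u j x - w x) 2 μ) atTop (𝓝 0) := by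
  have hsq : Tendsto (fun j => ∫⁻ x, ‖u j x - w x‖ₑ ^ 2 ∂μ) atTop (𝓝 (∫⁻ _, 0 ∂μ)) := by
    refine tendsto_lintegral_of_dominated_convergence' (fun x => ‖2 * g x‖ₑ ^ 2)
      (fun j => (((hu j).sub hw).enorm.pow_const 2)) (fun j => ?_) ?_ ?_
    · filter_upwards [ae_all_iff.2 hbound, hlim] with x hx hl
      have h1 : |w x| ≤ g x := le_of_tendsto hl.abs (.of_forall hx)
      gcongr
      rw [enorm_le_iff_norm_le, Real.norm_eq_abs, Real.norm_eq_abs]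
      have h2 := abs_sub (u j x) (w x)
      have h3 := hx j
      exact (h2.trans (by linarith)).trans (le_abs_self _)
    · have := (hg.const_mul 2).eLpNorm_ne_top
      rw [← eLpNorm_two_sq]
      exact ENNReal.pow_ne_top this
    · filter_upwards [hlim] with x hl
      have h1 : Tendsto (fun j => u j x - w x) atTop (𝓝 0) := by
        simpa using hl.sub_const (w x)
      have h2 := (ENNReal.continuous_pow 2).tendsto _ |>.comp h1.enorm
      simpa [Function.comp_def] using h2
  rw [lintegral_zero] at hsq
  simp_rw [← eLpNorm_two_sq] at hsq
  -- The squares of the norms tend to zero; take square roots.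
  have h := (ENNReal.continuous_rpow_const (y := (1 / 2 : ℝ))).tendsto 0 |>.comp hsq
  rw [ENNReal.zero_rpow_of_pos (by norm_num)] at h
  refine h.congr fun j => ?_
  simp only [Function.comp]
  rw [← ENNReal.rpow_natCast, ← ENNReal.rpow_mul]
  norm_num

end WeakL2

/-- The product of Lebesgue measure on `(0,T)` and on `ℝ`. -/
noncomputable abbrev stripMeasure (T : ℝ) : Measure (ℝ × ℝ) := (timeMeasure T).prod volume

instance isFiniteMeasure_timeMeasure (T : ℝ) : IsFiniteMeasure (timeMeasure T) := by
  unfold timeMeasure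
  infer_instance

/-! ### Spatial increments, mollification and comparison of dyadic scales -/

section Shift

variable {T : ℝ} {u : ℝ × ℝ → ℝ}

theorem measurePreserving_shift (T h : ℝ) :
    MeasurePreserving (fun p : ℝ × ℝ => (p.1, p.2 + h)) (stripMeasure T) (stripMeasure T) :=
  (MeasurePreserving.id (timeMeasure T)).prod (measurePreserving_add_right volume h)

/-- The `L²` norm over the strip of the increment of `u` under a spatial shift by `h`. -/
noncomputable def shiftNorm (T : ℝ) (u : ℝ × ℝ → ℝ) (h : ℝ) : ℝ≥0∞ :=
  eLpNorm (fun p => u (p.1, p.2 + h) - u p) 2 (stripMeasure T)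

/-- An increment by 2h is the sum of an increment by h and a translate of it, and translations in
space preserve the strip measure. -/
theorem shiftNorm_two_mul_le (hu : StronglyMeasurable u) (h : ℝ) :
    shiftNorm T u (2 * h) ≤ 2 * shiftNorm T u h := by
  have hm : ∀ a : ℝ, Measurable fun p : ℝ × ℝ => (p.1, p.2 + a) := fun a => by fun_prop
  have hs : ∀ a : ℝ, StronglyMeasurable fun p : ℝ × ℝ => u (p.1, p.2 + a) := fun a =>
    hu.comp_measurable (hm a)
  have h1 : shiftNorm T u h =
      eLpNorm (fun p => u (p.1, p.2 + h + h) - u (p.1, p.2 + h)) 2 (stripMeasure T) :=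
    (eLpNorm_comp_measurePreserving ((hs h).sub hu).aestronglyMeasurable
      (measurePreserving_shift T h)).symm
  have h2 : shiftNorm T u (2 * h) = eLpNorm ((fun p => u (p.1, p.2 + h + h) - u (p.1, p.2 + h)) +
      (fun p => u (p.1, p.2 + h) - u p)) 2 (stripMeasure T) := by
    unfold shiftNorm
    congr 1
    ext p
    simp only [Pi.add_apply]
    rw [show p.2 + 2 * h = p.2 + h + h by ring]
    ring
  rw [h2, two_mul]
  have h3 : StronglyMeasurable fun p : ℝ × ℝ => u (p.1, p.2 + h + h) := by
    simpa only [add_assoc] using hs (h + h)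
  refine (eLpNorm_add_le (h3.sub (hs h)).aestronglyMeasurable
    ((hs h).sub hu).aestronglyMeasurable (by norm_num)).trans ?_
  exact (congrArg₂ (· + ·) h1.symm rfl).le

theorem shiftNorm_two_pow_mul_le (hu : StronglyMeasurable u) (i : ℕ) (h : ℝ) :
    shiftNorm T u (2 ^ i * h) ≤ 2 ^ i * shiftNorm T u h := by
  induction i with
  | zero => simp
  | succ i ih =>
    rw [pow_succ', mul_assoc]
    refine (shiftNorm_two_mul_le hu _).trans ?_
    rw [pow_succ', mul_assoc]
    gcongr

theorem measurable_shiftNorm_sq (hu : StronglyMeasurable u) :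
    Measurable fun h => shiftNorm T u h ^ 2 := by
  simp only [shiftNorm, eLpNorm_two_sq]
  refine Measurable.lintegral_prod_right' (f := fun q : ℝ × (ℝ × ℝ) =>
    ‖u (q.2.1, q.2.2 + q.1) - u q.2‖ₑ ^ 2) ?_
  have := hu.measurable
  fun_prop

theorem lintegral_comp_mul_left_of_pos {a : ℝ} (ha : 0 < a) {F : ℝ → ℝ≥0∞} (hF : Measurable F) :
    ENNReal.ofReal a * ∫⁻ x, F (a * x) = ∫⁻ x, F x := by
  conv_rhs => rw [← Real.smul_map_volume_mul_left ha.ne']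
  rw [lintegral_smul_measure, lintegral_map hF (by fun_prop), abs_of_pos ha, smul_eq_mul]

/-- The substitution z = n w moves the scale from the kernel into the argument, so that energies at
different scales become integrals against the same weight `ρ`. -/
theorem lintegral_rescaledKernel_mul {ρ : ℝ → ℝ} (hρ : Measurable ρ)
    {n : ℕ} (hn : 1 ≤ n) {F : ℝ → ℝ≥0∞} (hF : Measurable F) :
    ∫⁻ w, ENNReal.ofReal (rescaledKernel ρ n w) * F w
      = ∫⁻ z, ENNReal.ofReal (ρ z) * F (z / n) := by
  have hn' : (0 : ℝ) < n := by exact_mod_cast hn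
  rw [← lintegral_comp_mul_left_of_pos hn' (F := fun z => ENNReal.ofReal (ρ z) * F (z / n))
    (by fun_prop), ← lintegral_const_mul' _ _ (by simp)]
  refine lintegral_congr fun w => ?_
  rw [rescaledKernel, ENNReal.ofReal_mul hn'.le, mul_div_cancel_left₀ _ hn'.ne', mul_assoc]

theorem measurable_rescaledKernel {ρ : ℝ → ℝ} (hρ : Measurable ρ) (n : ℕ) :
    Measurable (rescaledKernel ρ n) := by
  unfold rescaledKernel
  fun_prop

/-- The nonlocal energy is the kernel average of the squared shift norms. -/
theorem nonlocalEnergy_eq {ρ : ℝ → ℝ} (hρ : Measurable ρ) (hρ0 : ∀ x, 0 ≤ ρ x) (n : ℕ)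
    {f : ℝ → ℝ → ℝ} (hu : StronglyMeasurable u)
    (hfu : (fun p : ℝ × ℝ => f p.1 p.2) =ᵐ[stripMeasure T] u) :
    nonlocalEnergy ρ T n f =
      n ^ 2 * ∫⁻ w, ENNReal.ofReal (rescaledKernel ρ n w) * shiftNorm T u w ^ 2 := by
  unfold nonlocalEnergy
  congr 1
  have hK := measurable_rescaledKernel hρ n
  have hum := hu.measurable
  have h1 : ∀ᵐ t ∂(timeMeasure T), (∫⁻ y, ∫⁻ x,
      ENNReal.ofReal (rescaledKernel ρ n (x - y) * (f t x - f t y) ^ 2)) =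
      ∫⁻ y, ∫⁻ w, ENNReal.ofReal (rescaledKernel ρ n w) * ‖u (t, y + w) - u (t, y)‖ₑ ^ 2 := by
    filter_upwards [Measure.ae_ae_of_ae_prod hfu] with t ht
    refine lintegral_congr_ae ?_
    filter_upwards [ht] with y hy
    rw [← lintegral_add_right_eq_self (μ := volume) _ y]
    refine lintegral_congr_ae ?_
    have hsh := (measurePreserving_add_right volume y).quasiMeasurePreserving.ae ht
    filter_upwards [hsh] with w hw
    rw [hy, hw, add_sub_cancel_right, add_comm w y,
      ENNReal.ofReal_mul (show 0 ≤ rescaledKernel ρ n w from mul_nonneg n.cast_nonneg (hρ0 _)), ← enorm_pow,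
      Real.enorm_of_nonneg (sq_nonneg _)]
  rw [show volume.restrict (Ioo 0 T) = timeMeasure T from rfl, lintegral_congr_ae h1]
  simp only [shiftNorm, eLpNorm_two_sq]
  simp_rw [← lintegral_const_mul' (ENNReal.ofReal _) _ ENNReal.ofReal_ne_top]
  rw [lintegral_lintegral_swap (f := fun w (p : ℝ × ℝ) =>
    ENNReal.ofReal (rescaledKernel ρ n w) * ‖u (p.1, p.2 + w) - u p‖ₑ ^ 2)
    (Measurable.aemeasurable (by unfold Function.uncurry; fun_prop)), lintegral_prod]
  exact Measurable.aemeasurable (Measurable.lintegral_prod_right' (f := fun q : (ℝ × ℝ) × ℝ =>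
    ENNReal.ofReal (rescaledKernel ρ n q.2) * ‖u (q.1.1, q.1.2 + q.2) - u q.1‖ₑ ^ 2) (by fun_prop))

theorem memLp_two_section (hu : StronglyMeasurable u) (h2 : MemLp u 2 (stripMeasure T)) :
    ∀ᵐ t ∂(timeMeasure T), MemLp (fun x => u (t, x)) 2 volume := by
  have hm := hu.measurable
  have h : ∫⁻ p, ‖u p‖ₑ ^ 2 ∂(stripMeasure T) ≠ ⊤ := by
    rw [← eLpNorm_two_sq]
    exact ENNReal.pow_ne_top h2.eLpNorm_ne_top
  rw [lintegral_prod _ (by fun_prop)] at h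
  filter_upwards [ae_lt_top (Measurable.lintegral_prod_right' (f := fun p : ℝ × ℝ => ‖u p‖ₑ ^ 2)
    (by fun_prop)) h] with t ht
  refine ⟨(hu.comp_measurable (by fun_prop)).aestronglyMeasurable, ?_⟩
  rw [← eLpNorm_two_sq (fun x => u (t, x))] at ht
  simpa using ht

/-- Jensen's inequality for the square and a probability density. -/
theorem enorm_integral_density_sq_le {η : ℝ → ℝ} (hη : Continuous η) (hη0 : ∀ x, 0 ≤ η x)
    (hη1 : ∫ x, η x = 1) {d : ℝ → ℝ} (hd : AEStronglyMeasurable d volume) :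
    ‖∫ w, η w * d w‖ₑ ^ 2 ≤ ∫⁻ w, ENNReal.ofReal (η w) * ‖d w‖ₑ ^ 2 := by
  have hηm : Measurable fun w => ENNReal.ofReal (η w) := by fun_prop
  set ν := volume.withDensity fun w => ENNReal.ofReal (η w) with hν
  -- A non-integrable function has Bochner integral 0, not 1.
  have hint : Integrable η := by
    by_contra h
    rw [integral_undef h] at hη1
    exact zero_ne_one hη1
  have : IsProbabilityMeasure ν := ⟨by
    rw [hν, withDensity_apply _ MeasurableSet.univ, setLIntegral_univ,
      ← ofReal_integral_eq_lintegral_ofReal hint (.of_forall hη0), hη1, ENNReal.ofReal_one]⟩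
  have hdν : AEStronglyMeasurable d ν := hd.mono_ac (withDensity_absolutelyContinuous _ _)
  have h1 : ‖∫ w, η w * d w‖ₑ ≤ eLpNorm d 1 ν := by
    refine (enorm_integral_le_lintegral_enorm _).trans ?_
    rw [eLpNorm_one_eq_lintegral_enorm, hν, lintegral_withDensity_eq_lintegral_mul₀
      hηm.aemeasurable hd.enorm]
    refine lintegral_mono fun w => ?_
    simp only [Pi.mul_apply, enorm_mul, Real.enorm_of_nonneg (hη0 w), le_refl]
  have h2 : eLpNorm d 1 ν ≤ eLpNorm d 2 ν :=
    eLpNorm_le_eLpNorm_of_exponent_le (by norm_num) hdν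
  calc ‖∫ w, η w * d w‖ₑ ^ 2 ≤ eLpNorm d 2 ν ^ 2 := by gcongr; exact h1.trans h2
    _ = _ := by
      rw [eLpNorm_two_sq, hν, lintegral_withDensity_eq_lintegral_mul₀ hηm.aemeasurable
        (hd.enorm.pow_const 2)]
      rfl

/-- Convolution in space of a function on the strip with the reflected kernel `η`. -/
noncomputable def mollify (η : ℝ → ℝ) (u : ℝ × ℝ → ℝ) (p : ℝ × ℝ) : ℝ :=
  ∫ y, u (p.1, y) * η (y - p.2)

theorem stronglyMeasurable_mollify {η : ℝ → ℝ} (hη : Continuous η) (hu : StronglyMeasurable u) :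
    StronglyMeasurable (mollify η u) := by
  refine StronglyMeasurable.integral_prod_right' (f := fun q : (ℝ × ℝ) × ℝ =>
    u (q.1.1, q.2) * η (q.2 - q.1.2)) ?_
  have := hu.measurable
  have := hη.measurable
  exact Measurable.stronglyMeasurable (by fun_prop)

/-- The distance of a function to its mollification is controlled by the kernel average of the
squared shift norms. -/
theorem eLpNorm_sub_mollify_sq_le {η : ℝ → ℝ} (hη : Continuous η) (hηc : HasCompactSupport η)
    (hη0 : ∀ x, 0 ≤ η x) (hη1 : ∫ x, η x = 1) (hu : StronglyMeasurable u)
    (h2 : MemLp u 2 (stripMeasure T)) :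
    eLpNorm (fun p => u p - mollify η u p) 2 (stripMeasure T) ^ 2 ≤
      ∫⁻ w, ENNReal.ofReal (η w) * shiftNorm T u w ^ 2 := by
  have hum := hu.measurable
  have hηm := hη.measurable
  have hpt : ∀ᵐ p ∂(stripMeasure T), ‖u p - mollify η u p‖ₑ ^ 2 ≤
      ∫⁻ w, ENNReal.ofReal (η w) * ‖u (p.1, p.2 + w) - u p‖ₑ ^ 2 := by
    filter_upwards [Measure.quasiMeasurePreserving_fst.ae (memLp_two_section hu h2)] with p hp
    have hp' : MemLp (fun w => u (p.1, w + p.2)) 2 volume :=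
      hp.comp_measurePreserving (measurePreserving_add_right volume p.2)
    have hηint : Integrable η := hη.integrable_of_hasCompactSupport hηc
    have hint : Integrable fun w => u (p.1, w + p.2) * η w :=
      MemLp.integrable_fun_mul hp' (hη.memLp_of_hasCompactSupport hηc)
    -- Because `η` has integral one, the mollification error is an average of increments, to which
    -- Jensen's inequality applies.
    have e : mollify η u p - u p = ∫ w, η w * (u (p.1, p.2 + w) - u p) := by
      have e1 : mollify η u p = ∫ w, u (p.1, w + p.2) * η w := by
        rw [mollify, ← integral_add_right_eq_self _ p.2]
        simp only [add_sub_cancel_right]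
      have e2 : u p = ∫ w, η w * u p := by rw [integral_mul_const, hη1, one_mul]
      conv_lhs => rw [e1, e2]
      rw [← integral_sub hint (hηint.mul_const _)]
      refine integral_congr_ae (.of_forall fun w => ?_)
      simp only [add_comm p.2 w]
      ring
    rw [← enorm_neg, neg_sub, e]
    exact enorm_integral_density_sq_le hη hη0 hη1
      (Measurable.aestronglyMeasurable (by fun_prop))
  rw [eLpNorm_two_sq]
  refine (lintegral_mono_ae hpt).trans ?_
  simp only [shiftNorm, eLpNorm_two_sq]
  simp_rw [← lintegral_const_mul' (ENNReal.ofReal _) _ ENNReal.ofReal_ne_top]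
  rw [lintegral_lintegral_swap]
  exact Measurable.aemeasurable (by unfold Function.uncurry; fun_prop)

/-- The shift z/2^m is 2^(j-m) times the shift z/2^j, so its norm is larger by a factor of at most
2^(j-m); and 4^m (2^(j-m))² = 4^j. This transfers the bound at the fine scale, where the hypothesis
lives, to all coarser ones. -/
theorem lintegral_rescaledKernel_two_pow_mono {ρ : ℝ → ℝ} (hρ : Measurable ρ)
    (hu : StronglyMeasurable u) {m j : ℕ} (hmj : m ≤ j) :
    4 ^ m * ∫⁻ w, ENNReal.ofReal (rescaledKernel ρ (2 ^ m) w) * shiftNorm T u w ^ 2 ≤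
      4 ^ j * ∫⁻ w, ENNReal.ofReal (rescaledKernel ρ (2 ^ j) w) * shiftNorm T u w ^ 2 := by
  have hA := measurable_shiftNorm_sq (T := T) hu
  rw [lintegral_rescaledKernel_mul hρ Nat.one_le_two_pow hA,
    lintegral_rescaledKernel_mul hρ Nat.one_le_two_pow hA,
    ← lintegral_const_mul' _ _ (by simp), ← lintegral_const_mul' _ _ (by simp)]
  refine lintegral_mono fun z => ?_
  have h := shiftNorm_two_pow_mul_le (T := T) hu (j - m) (z / ((2 ^ j : ℕ) : ℝ))
  have e : (2 : ℝ) ^ (j - m) * (z / ((2 ^ j : ℕ) : ℝ)) = z / ((2 ^ m : ℕ) : ℝ) := by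
    push_cast
    rw [← Nat.sub_add_cancel hmj, pow_add, Nat.add_sub_cancel]
    field_simp
  rw [e] at h
  calc 4 ^ m * (ENNReal.ofReal (ρ z) * shiftNorm T u (z / ((2 ^ m : ℕ) : ℝ)) ^ 2)
      ≤ 4 ^ m * (ENNReal.ofReal (ρ z) *
          (2 ^ (j - m) * shiftNorm T u (z / ((2 ^ j : ℕ) : ℝ))) ^ 2) := by gcongr
    _ = 4 ^ m * (2 ^ (j - m)) ^ 2 *
          (ENNReal.ofReal (ρ z) * shiftNorm T u (z / ((2 ^ j : ℕ) : ℝ)) ^ 2) := by ring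
    _ = 4 ^ j * (ENNReal.ofReal (ρ z) * shiftNorm T u (z / ((2 ^ j : ℕ) : ℝ)) ^ 2) := by
      congr 1
      rw [← pow_mul, mul_comm (j - m) 2, pow_mul, ← Nat.add_sub_cancel' hmj, pow_add,
        Nat.add_sub_cancel_left]
      norm_num

end Shift

/-! ### Weak derivatives in time and convergence almost everywhere -/

section TimeCompactness

/-- A smooth function with support in `[a,b]` and integral zero is the derivative of a smooth
function with support in `[a,b]`. -/
theorem exists_primitive_of_integral_eq_zero {η : ℝ → ℝ} (hη : ContDiff ℝ ∞ η) {a b : ℝ}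
    (hsupp : ∀ x, x ∉ Icc a b → η x = 0) (h0 : ∫ x, η x = 0) :
    ∃ θ : ℝ → ℝ, ContDiff ℝ ∞ θ ∧ deriv θ = η ∧ (∀ x, x ∉ Icc a b → θ x = 0) ∧
      ∀ x, |θ x| ≤ ∫ y, |η y| := by
  have hc := hη.continuous
  have hcs : HasCompactSupport η := HasCompactSupport.intro isCompact_Icc hsupp
  have hint : Integrable η := hc.integrable_of_hasCompactSupport hcs
  have hI : ∀ x y, IntervalIntegrable η volume x y := fun x y => hc.intervalIntegrable x y
  -- Starting at a - 1 rather than a places all of [a, b] inside the half-open interval of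
  -- integration once x > b.
  have hderiv : ∀ x, HasDerivAt (fun s => ∫ y in (a - 1)..s, η y) (η x) x := fun x =>
    intervalIntegral.integral_hasDerivAt_right (hI _ x)
      (hc.stronglyMeasurableAtFilter _ _) hc.continuousAt
  have hd : deriv (fun s => ∫ y in (a - 1)..s, η y) = η := funext fun x => (hderiv x).deriv
  refine ⟨fun s => ∫ y in (a - 1)..s, η y, ?_, hd, fun x hx => ?_, fun x => ?_⟩
  · rw [contDiff_infty_iff_deriv, hd]
    exact ⟨fun x => (hderiv x).differentiableAt, hη⟩
  · rcases lt_or_ge x a with h | h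
    · refine intervalIntegral.integral_zero_ae (.of_forall fun y hy => hsupp y fun hy' => ?_)
      have := (mem_uIoc.1 hy)
      rcases this with h1 | h1 <;> linarith [h1.2, hy'.1]
    · have hbx : b < x := by
        by_contra h'
        exact hx ⟨h, not_lt.1 h'⟩
      simp only
      rw [intervalIntegral.integral_eq_integral_of_support_subset, h0]
      intro y hy
      have hy' : y ∈ Icc a b := by_contra fun h' => hy (hsupp y h')
      exact ⟨by linarith [hy'.1], hy'.2.trans hbx.le⟩
  · have h1 := intervalIntegral.norm_integral_le_integral_norm_uIoc (f := η) (μ := volume)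
      (a := a - 1) (b := x)
    exact h1.trans (setIntegral_le_integral hint.norm (.of_forall fun y => norm_nonneg _))

/-- The standard bump function at the origin with outer radius `r`. -/
noncomputable def stdBump (r : ℝ) (hr : 0 < r) : ContDiffBump (0 : ℝ) where
  rIn := r / 2
  rOut := r
  rIn_pos := by positivity
  rIn_lt_rOut := by linarith

theorem normed_stdBump_eq_zero {r : ℝ} (hr : 0 < r) {x : ℝ} (hx : r ≤ |x|) :
    (stdBump r hr).normed volume x = 0 := by
  have h := (stdBump r hr).support_normed_eq (μ := volume)
  by_contra h'
  have : x ∈ Function.support ((stdBump r hr).normed volume) := h'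
  rw [h, Metric.mem_ball, dist_zero_right, Real.norm_eq_abs] at this
  exact absurd hx (not_le.2 this)

theorem contDiff_normed_stdBump_sub {r : ℝ} (hr : 0 < r) (t : ℝ) :
    ContDiff ℝ ∞ fun s => (stdBump r hr).normed volume (t - s) :=
  (ContDiffBump.contDiff_normed _).comp (contDiff_const.sub contDiff_id)

theorem isTestOn_of_eq_zero {φ : ℝ → ℝ} (hφ : ContDiff ℝ ∞ φ) {a b : ℝ} {U : Set ℝ}
    (hU : Icc a b ⊆ U) (h : ∀ x, x ∉ Icc a b → φ x = 0) : IsTestOn U φ :=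
  ⟨hφ, HasCompactSupport.intro isCompact_Icc h,
    (closure_minimal (fun x (hx : φ x ≠ 0) => by_contra fun h' => hx (h x h'))
      isClosed_Icc).trans hU⟩

theorem isTestOn_normed_stdBump_sub {r : ℝ} (hr : 0 < r) {t : ℝ} {U : Set ℝ}
    (hU : Icc (t - r) (t + r) ⊆ U) :
    IsTestOn U fun s => (stdBump r hr).normed volume (t - s) := by
  refine isTestOn_of_eq_zero (contDiff_normed_stdBump_sub hr t) hU fun x hx => ?_
  refine normed_stdBump_eq_zero hr (le_of_not_gt fun h => hx ?_)
  rw [abs_lt] at h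
  constructor <;> linarith [h.1, h.2]

variable {T B : ℝ} {a b : ℝ → ℝ}

/-- Mollifications at scales `r' ≤ r` of a function with weak derivative in `L²` differ by
`O(√r)`. -/
theorem abs_sub_mollification_le (hB : 0 ≤ B) (ha : Integrable a (timeMeasure T))
    (hb : MemLp b 2 (timeMeasure T)) (hbB : (eLpNorm b 2 (timeMeasure T)).toReal ≤ B)
    (hderiv : ∀ φ, IsTestOn (Ioo 0 T) φ →
      ∫ t, deriv φ t * a t ∂(timeMeasure T) = -∫ t, φ t * b t ∂(timeMeasure T))
    {t r r' : ℝ} (hr : 0 < r) (hr' : 0 < r') (hle : r' ≤ r)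
    (ht : Icc (t - r) (t + r) ⊆ Ioo 0 T) :
    |(∫ s, (stdBump r hr).normed volume (t - s) * a s ∂(timeMeasure T)) -
      ∫ s, (stdBump r' hr').normed volume (t - s) * a s ∂(timeMeasure T)| ≤
      B * (2 * √(2 * r)) := by
  set p := fun s => (stdBump r hr).normed volume (t - s) with hp
  set q := fun s => (stdBump r' hr').normed volume (t - s) with hq
  have hpt : IsTestOn (Ioo 0 T) p := isTestOn_normed_stdBump_sub hr ht
  have hsub : Icc (t - r') (t + r') ⊆ Icc (t - r) (t + r) :=
    Icc_subset_Icc (by linarith) (by linarith)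
  have hqt : IsTestOn (Ioo 0 T) q := isTestOn_normed_stdBump_sub hr' (hsub.trans ht)
  have hp1 : ∫ s, p s = 1 := by
    rw [hp, integral_sub_left_eq_self (fun s => (stdBump r hr).normed volume s)]
    exact ContDiffBump.integral_normed _
  have hq1 : ∫ s, q s = 1 := by
    rw [hq, integral_sub_left_eq_self (fun s => (stdBump r' hr').normed volume s)]
    exact ContDiffBump.integral_normed _
  have hpi : Integrable p := hpt.smooth.continuous.integrable_of_hasCompactSupport hpt.compact
  have hqi : Integrable q := hqt.smooth.continuous.integrable_of_hasCompactSupport hqt.compact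
  have hp0 : ∀ s, 0 ≤ p s := fun s => ContDiffBump.nonneg_normed _ _
  have hq0 : ∀ s, 0 ≤ q s := fun s => ContDiffBump.nonneg_normed _ _
  -- The difference of the two kernels has integral zero, hence is θ' for a test function θ with |θ|
  -- ≤ 2 on an interval of length 2r. The difference of the mollifications is then -∫ b θ, and ‖θ‖₂
  -- ≤ 2√(2r).
  obtain ⟨θ, hθ, hθd, hθ0, hθb⟩ := exists_primitive_of_integral_eq_zero
    (η := fun s => p s - q s) (hpt.smooth.sub hqt.smooth) (a := t - r) (b := t + r)
    (fun x hx => by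
      have hx' : r ≤ |t - x| := le_of_not_gt fun h => hx (by
        rw [abs_lt] at h
        constructor <;> linarith [h.1, h.2])
      simp only [hp, hq]
      rw [normed_stdBump_eq_zero hr hx', normed_stdBump_eq_zero hr' (hle.trans hx'), sub_zero])
    (by rw [integral_sub hpi hqi, hp1, hq1, sub_self])
  have hθt : IsTestOn (Ioo 0 T) θ := isTestOn_of_eq_zero hθ ht hθ0
  have hθ2 : ∀ x, |θ x| ≤ 2 := fun x => by
    refine (hθb x).trans ?_
    calc ∫ y, |p y - q y| ≤ ∫ y, (p y + q y) := by
          refine integral_mono (hpi.sub hqi).abs (hpi.add hqi) fun y => ?_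
          refine (abs_sub _ _).trans ?_
          rw [abs_of_nonneg (hp0 y), abs_of_nonneg (hq0 y)]
      _ = 2 := by rw [integral_add hpi hqi, hp1, hq1]; norm_num
  have hbd : ∀ φ, IsTestOn (Ioo 0 T) φ → Integrable (fun s => φ s * a s) (timeMeasure T) := by
    intro φ hφ
    obtain ⟨C, hC⟩ := hφ.smooth.continuous.bounded_above_of_compact_support hφ.compact
    exact ha.bdd_mul hφ.smooth.continuous.aestronglyMeasurable (.of_forall hC)
  have e : (∫ s, p s * a s ∂(timeMeasure T)) - ∫ s, q s * a s ∂(timeMeasure T) =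
      -∫ s, b s * θ s ∂(timeMeasure T) := by
    simp only [mul_comm (b _)]
    rw [← hderiv θ hθt, hθd, ← integral_sub (hbd p hpt) (hbd q hqt)]
    simp only [sub_mul]
  have hθL : MemLp θ 2 (timeMeasure T) := hθ.continuous.memLp_of_hasCompactSupport hθt.compact
  have hθN : (eLpNorm θ 2 (timeMeasure T)).toReal ≤ 2 * √(2 * r) := by
    refine ENNReal.toReal_le_of_le_ofReal (by positivity) ?_
    calc eLpNorm θ 2 (timeMeasure T) ≤ eLpNorm θ 2 volume :=
          eLpNorm_mono_measure _ Measure.restrict_le_self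
      _ ≤ eLpNorm ((Icc (t - r) (t + r)).indicator fun _ => (2 : ℝ)) 2 volume := by
          refine eLpNorm_mono fun x => ?_
          by_cases hx : x ∈ Icc (t - r) (t + r)
          · simpa [hx] using hθ2 x
          · simp [hx, hθ0 x hx]
      _ = ENNReal.ofReal (2 * √(2 * r)) := by
          rw [eLpNorm_indicator_const measurableSet_Icc (by norm_num) (by norm_num),
            Real.volume_Icc, Real.sqrt_eq_rpow, ENNReal.ofReal_mul (by norm_num),
            ← ENNReal.ofReal_rpow_of_nonneg (by positivity) (by norm_num)]
          congr 1
          · simp [Real.enorm_eq_ofReal]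
          · rw [show t + r - (t - r) = 2 * r by ring]
            norm_num
  rw [e, abs_neg]
  exact (abs_integral_mul_le_eLpNorm_two hb hθL).trans
    (mul_le_mul hbB hθN ENNReal.toReal_nonneg hB)

/-- A function with weak derivative in `L²` is almost everywhere within `O(√r)` of its
mollification at scale `r`. -/
theorem ae_abs_sub_mollification_le (hB : 0 ≤ B) (ha : Integrable a (timeMeasure T))
    (hb : MemLp b 2 (timeMeasure T)) (hbB : (eLpNorm b 2 (timeMeasure T)).toReal ≤ B)
    (hderiv : ∀ φ, IsTestOn (Ioo 0 T) φ →
      ∫ t, deriv φ t * a t ∂(timeMeasure T) = -∫ t, φ t * b t ∂(timeMeasure T)) :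
    ∀ᵐ t ∂(timeMeasure T), ∀ r (hr : 0 < r), Icc (t - r) (t + r) ⊆ Ioo 0 T →
      |(∫ s, (stdBump r hr).normed volume (t - s) * a s ∂(timeMeasure T)) - a t| ≤
        B * (2 * √(2 * r)) := by
  have hg : Integrable ((Ioo 0 T).indicator a) :=
    (integrable_indicator_iff measurableSet_Ioo).2 ha
  have hpos : ∀ n : ℕ, (0 : ℝ) < 1 / ((n : ℝ) + 1) := fun n => by positivity
  -- Lebesgue differentiation along the scales 1/(n+1), with `K = 2` the ratio of the bump radii.
  -- The exceptional null set comes from this limit alone, so one set serves all r.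
  have hlim := ContDiffBump.ae_convolution_tendsto_right_of_locallyIntegrable (μ := volume)
    (φ := fun n : ℕ => stdBump (1 / ((n : ℝ) + 1)) (hpos n)) (l := atTop) (K := 2)
    (g := (Ioo 0 T).indicator a) tendsto_one_div_add_atTop_nhds_zero_nat
    (.of_forall fun n => by simp only [stdBump]; linarith) hg.locallyIntegrable
  rw [timeMeasure, ae_restrict_iff' measurableSet_Ioo]
  filter_upwards [hlim] with t ht htT r hr hI
  rw [indicator_of_mem htT] at ht
  refine le_of_tendsto (ht.const_sub _).abs ?_
  filter_upwards [tendsto_one_div_add_atTop_nhds_zero_nat.eventually (gt_mem_nhds hr)] with n hn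
  have h := abs_sub_mollification_le hB ha hb hbB hderiv hr (hpos n) hn.le hI
  have e : convolution ((stdBump (1 / ((n : ℝ) + 1)) (hpos n)).normed volume)
      ((Ioo 0 T).indicator a) (ContinuousLinearMap.lsmul ℝ ℝ) volume t =
      ∫ s, (stdBump (1 / ((n : ℝ) + 1)) (hpos n)).normed volume (t - s) * a s ∂(timeMeasure T) := by
    rw [convolution_eq_swap, timeMeasure, ← integral_indicator measurableSet_Ioo]
    refine integral_congr_ae (.of_forall fun s => ?_)
    by_cases hs : s ∈ Ioo 0 T <;> simp [hs]
  rw [e]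
  exact h

/-- Sequences with bounded weak derivatives in `L²(0,T)` which converge in the sense of
distributions converge almost everywhere. -/
theorem ae_exists_tendsto_of_weakDeriv {a b : ℕ → ℝ → ℝ}
    (ha : ∀ j, Integrable (a j) (timeMeasure T)) (hb : ∀ j, MemLp (b j) 2 (timeMeasure T))
    (hbB : ∀ j, (eLpNorm (b j) 2 (timeMeasure T)).toReal ≤ B)
    (hderiv : ∀ j φ, IsTestOn (Ioo 0 T) φ →
      ∫ t, deriv φ t * a j t ∂(timeMeasure T) = -∫ t, φ t * b j t ∂(timeMeasure T))
    (hconv : ∀ φ, IsTestOn (Ioo 0 T) φ →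
      ∃ l, Tendsto (fun j => ∫ t, φ t * a j t ∂(timeMeasure T)) atTop (𝓝 l)) :
    ∀ᵐ t ∂(timeMeasure T), ∃ l, Tendsto (fun j => a j t) atTop (𝓝 l) := by
  have hB : 0 ≤ B := ENNReal.toReal_nonneg.trans (hbB 0)
  have hall := ae_all_iff.2 fun j => ae_abs_sub_mollification_le hB (ha j) (hb j) (hbB j) (hderiv j)
  have hmem : ∀ᵐ t ∂(timeMeasure T), t ∈ Ioo 0 T := ae_restrict_mem measurableSet_Ioo
  filter_upwards [hall, hmem] with t ht htT
  refine cauchySeq_tendsto_of_complete (Metric.cauchySeq_iff'.2 fun ε hε => ?_)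
  -- The scale r is fixed independently of the index: each term is within ε/4 of its mollification,
  -- and the mollifications converge by `hconv`, so three errors of ε/4 add up to less than ε.
  obtain ⟨r, hr, hrI, hrε⟩ : ∃ r, 0 < r ∧ Icc (t - r) (t + r) ⊆ Ioo 0 T ∧
      B * (2 * √(2 * r)) < ε / 4 := by
    have h1 : Tendsto (fun r : ℝ => B * (2 * √(2 * r))) (𝓝[>] 0) (𝓝 0) := by
      have : Continuous fun r : ℝ => B * (2 * √(2 * r)) := by fun_prop
      have h := this.tendsto 0
      simp only [mul_zero, Real.sqrt_zero] at h
      exact h.mono_left nhdsWithin_le_nhds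
    have h2 : ∀ᶠ r : ℝ in 𝓝[>] 0, r < min t (T - t) :=
      nhdsWithin_le_nhds (gt_mem_nhds (lt_min htT.1 (sub_pos.2 htT.2)))
    obtain ⟨r, h3, h4, h5⟩ := ((h1.eventually (gt_mem_nhds (show (0 : ℝ) < ε / 4 by positivity))).and
      (h2.and self_mem_nhdsWithin)).exists
    refine ⟨r, h5, fun s hs => ?_, h3⟩
    have := lt_min_iff.1 h4
    exact ⟨by linarith [hs.1, this.1], by linarith [hs.2, this.2]⟩
  obtain ⟨l, hl⟩ := hconv _ (isTestOn_normed_stdBump_sub hr hrI)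
  obtain ⟨N, hN⟩ := Metric.cauchySeq_iff'.1 hl.cauchySeq (ε / 4) (by positivity)
  refine ⟨N, fun n hn => ?_⟩
  have h1 := hN n hn
  have h2 := ht n r hr hrI
  have h3 := ht N r hr hrI
  rw [Real.dist_eq] at h1 ⊢
  rw [abs_lt] at h1 ⊢
  rw [abs_le] at h2 h3
  constructor <;> linarith [h1.1, h1.2, h2.1, h2.2, h3.1, h3.2]

end TimeCompactness

/-! ### Test functions as elements of H¹ -/

section TestFunctions

theorem IsTestOn.continuous {U : Set ℝ} {φ : ℝ → ℝ} (h : IsTestOn U φ) : Continuous φ :=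
  h.smooth.continuous

theorem IsTestOn.memLp {U : Set ℝ} {φ : ℝ → ℝ} (h : IsTestOn U φ) (μ : Measure ℝ)
    [IsFiniteMeasureOnCompacts μ] : MemLp φ 2 μ :=
  h.continuous.memLp_of_hasCompactSupport h.compact

theorem IsTestOn.comp_sub {φ : ℝ → ℝ} (h : IsTestOn univ φ) (x : ℝ) :
    IsTestOn univ fun y => φ (y - x) :=
  ⟨h.smooth.comp (contDiff_id.sub contDiff_const),
    h.compact.comp_homeomorph (Homeomorph.subRight x), subset_univ _⟩

theorem IsTestOn.deriv {U : Set ℝ} {φ : ℝ → ℝ} (h : IsTestOn U φ) : IsTestOn U (deriv φ) :=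
  ⟨(contDiff_infty_iff_deriv.1 h.smooth).2, h.compact.deriv,
    (closure_minimal support_deriv_subset (isClosed_tsupport _)).trans h.subset⟩

/-- Integration by parts for test functions. -/
theorem IsTestOn.integral_mul_deriv {η φ : ℝ → ℝ} (hη : IsTestOn univ η) (hφ : IsTestOn univ φ) :
    ∫ x, η x * _root_.deriv φ x = -∫ x, _root_.deriv η x * φ x := by
  refine integral_mul_deriv_eq_deriv_mul_of_integrable
    (fun x _ => (hη.smooth.differentiable (by simp) x).hasDerivAt)
    (fun x _ => (hφ.smooth.differentiable (by simp) x).hasDerivAt) ?_ ?_ ?_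
  · exact (hη.memLp volume).integrable_mul (hφ.deriv.memLp volume)
  · exact (hη.deriv.memLp volume).integrable_mul (hφ.memLp volume)
  · exact (hη.memLp volume).integrable_mul (hφ.memLp volume)

/-- Test functions belong to `H¹(ℝ)`. -/
theorem IsTestOn.exists_sobolevH1 {η : ℝ → ℝ} (hη : IsTestOn univ η) :
    ∃ v : SobolevH1, SobolevH1.toL2 v =ᵐ[volume] η := by
  have h1 := (hη.memLp volume).coeFn_toLp
  have h2 := (hη.deriv.memLp volume).coeFn_toLp
  refine ⟨⟨WithLp.toLp 2 ((hη.memLp volume).toLp η, (hη.deriv.memLp volume).toLp _),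
    fun φ hφ => ?_⟩, h1⟩
  calc _ = ∫ x, η x * _root_.deriv φ x := by
        refine integral_congr_ae ?_
        filter_upwards [h1] with x hx
        exact congrArg (· * _root_.deriv φ x) hx
    _ = -∫ x, _root_.deriv η x * φ x := hη.integral_mul_deriv hφ
    _ = _ := by
        congr 1
        refine integral_congr_ae ?_
        filter_upwards [h2] with x hx
        exact (congrArg (· * φ x) hx).symm

end TestFunctions

/-! ### Evaluating dual-valued functions at a fixed vector -/

section Evaluation

variable {α E : Type*} [MeasurableSpace α] {μ : Measure α} [NormedAddCommGroup E] [NormedSpace ℝ E]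

theorem eLpNorm_eval_le (G : α → StrongDual ℝ E) (v : E) :
    eLpNorm (fun t => G t v) 2 μ ≤ ENNReal.ofReal ‖v‖ * eLpNorm G 2 μ :=
  eLpNorm_le_mul_eLpNorm_of_ae_le_mul (.of_forall fun t => by
    rw [mul_comm]; exact (G t).le_opNorm v) 2

theorem memLp_eval {G : α → StrongDual ℝ E} (hG : MemLp G 2 μ) (v : E) :
    MemLp (fun t => G t v) 2 μ :=
  ⟨(by fun_prop : Continuous fun A : StrongDual ℝ E => A v).comp_aestronglyMeasurable hG.1,
    (eLpNorm_eval_le G v).trans_lt (ENNReal.mul_lt_top ENNReal.ofReal_lt_top hG.2)⟩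

end Evaluation

/-! ### Convergence of the mollified sequence -/

section MollifiedConvergence

variable {T C : ℝ} {η : ℝ → ℝ}

theorem memLp_two_tensor {α β : ℝ → ℝ} (hα : MemLp α 2 (timeMeasure T)) (hβ : MemLp β 2 volume) :
    MemLp (fun p : ℝ × ℝ => α p.1 * β p.2) 2 (stripMeasure T) := by
  have h1 := hα.aestronglyMeasurable.comp_fst (ν := (volume : Measure ℝ))
  have h2 := hβ.aestronglyMeasurable.comp_snd (μ := timeMeasure T)
  refine ⟨h1.mul h2, ?_⟩
  have e : eLpNorm (fun p : ℝ × ℝ => α p.1 * β p.2) 2 (stripMeasure T) ^ 2 =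
      eLpNorm α 2 (timeMeasure T) ^ 2 * eLpNorm β 2 volume ^ 2 := by
    simp only [eLpNorm_two_sq, enorm_mul, mul_pow]
    exact lintegral_prod_mul (hα.aestronglyMeasurable.enorm.pow_const 2)
      (hβ.aestronglyMeasurable.enorm.pow_const 2)
  have h : eLpNorm (fun p : ℝ × ℝ => α p.1 * β p.2) 2 (stripMeasure T) ^ 2 < ⊤ := by
    rw [e]
    exact ENNReal.mul_lt_top (ENNReal.pow_lt_top hα.2) (ENNReal.pow_lt_top hβ.2)
  simpa using h

theorem integral_strip_tensor {u : ℝ × ℝ → ℝ} (hu : MemLp u 2 (stripMeasure T)) {α β : ℝ → ℝ}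
    (hα : MemLp α 2 (timeMeasure T)) (hβ : MemLp β 2 volume) :
    ∫ p, u p * (α p.1 * β p.2) ∂(stripMeasure T) =
      ∫ t, α t * (∫ x, u (t, x) * β x) ∂(timeMeasure T) := by
  rw [integral_prod _ (MemLp.integrable_fun_mul hu (memLp_two_tensor hα hβ))]
  refine integral_congr_ae (.of_forall fun t => ?_)
  simp only
  rw [← integral_const_mul]
  refine integral_congr_ae (.of_forall fun x => ?_)
  simp only
  ring

/-- Cauchy–Schwarz on the slice, since translates of `η` share one norm. The bound depends on
neither `u` nor `p`, so a constant dominates the whole sequence on sets of finite measure. `max C 0`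
is the real value of `ENNReal.ofReal C`. -/
theorem abs_mollify_le (hη : IsTestOn univ η) {u : ℝ × ℝ → ℝ} (hu : StronglyMeasurable u)
    {p : ℝ × ℝ} (hp : eLpNorm (fun x => u (p.1, x)) 2 volume ≤ ENNReal.ofReal C) :
    |mollify η u p| ≤ max C 0 * (eLpNorm η 2 volume).toReal := by
  have h1 : MemLp (fun x => u (p.1, x)) 2 volume :=
    ⟨(hu.comp_measurable (by fun_prop)).aestronglyMeasurable, hp.trans_lt ENNReal.ofReal_lt_top⟩
  have h2 := (hη.comp_sub p.2).memLp volume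
  have h3 : eLpNorm (fun y => η (y - p.2)) 2 volume = eLpNorm η 2 volume :=
    eLpNorm_comp_measurePreserving hη.continuous.aestronglyMeasurable
      (measurePreserving_sub_right volume p.2)
  refine (abs_integral_mul_le_eLpNorm_two h1 h2).trans ?_
  rw [h3]
  refine mul_le_mul_of_nonneg_right ?_ ENNReal.toReal_nonneg
  refine (ENNReal.toReal_mono ENNReal.ofReal_ne_top hp).trans ?_
  rw [ENNReal.toReal_ofReal']

variable {u : ℕ → ℝ × ℝ → ℝ} {g : ℕ → ℝ → SobolevHneg1} {w : ℝ × ℝ → ℝ}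

/-- Spatial mollifications of a weakly convergent sequence with bounded time derivatives converge
almost everywhere. -/
theorem ae_exists_tendsto_mollify (hη : IsTestOn univ η) (hu : ∀ j, StronglyMeasurable (u j))
    (hu2 : ∀ j, MemLp (u j) 2 (stripMeasure T))
    (hbound : ∀ j, ∀ᵐ t ∂(timeMeasure T), eLpNorm (fun x => u j (t, x)) 2 volume ≤ ENNReal.ofReal C)
    (hg : ∀ j, MemLp (g j) 2 (timeMeasure T))
    (hgC : ∀ j, eLpNorm (g j) 2 (timeMeasure T) ≤ ENNReal.ofReal C)
    (hw : ∀ j, IsWeakTimeDeriv T (fun t x => u j (t, x)) (g j))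
    (hweak : WeakL2Tendsto (stripMeasure T) u w) :
    ∀ᵐ p ∂(stripMeasure T), ∃ l, Tendsto (fun j => mollify η (u j) p) atTop (𝓝 l) := by
  have hm : ∀ j, StronglyMeasurable (mollify η (u j)) := fun j =>
    stronglyMeasurable_mollify hη.continuous (hu j)
  have hS : MeasurableSet {p : ℝ × ℝ | ∃ l, Tendsto (fun j => mollify η (u j) p) atTop (𝓝 l)} :=
    StronglyMeasurable.measurableSet_exists_tendsto hm
  -- Exchanging the variables lets x be fixed first, so the translated kernel is a single `v` in H¹
  -- and t ↦ `g j t v` is the weak derivative of the mollification. The bound may depend on x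
  -- through ‖v‖.
  rw [Measure.ae_prod_iff_ae_ae hS, Measure.ae_ae_comm (p := fun t x =>
    ∃ l, Tendsto (fun j => mollify η (u j) (t, x)) atTop (𝓝 l)) hS]
  refine .of_forall fun x => ?_
  obtain ⟨v, hv⟩ := (hη.comp_sub x).exists_sobolevH1
  have hpair : ∀ j t, ∫ y, u j (t, y) * SobolevH1.toL2 v y = mollify η (u j) (t, x) := by
    intro j t
    refine integral_congr_ae ?_
    filter_upwards [hv] with y hy
    rw [hy]
  have hbm : ∀ j, MemLp (fun t => g j t v) 2 (timeMeasure T) := fun j => memLp_eval (hg j) v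
  refine ae_exists_tendsto_of_weakDeriv (a := fun j t => mollify η (u j) (t, x))
    (b := fun j t => g j t v) (B := ‖v‖ * max C 0) (fun j => ?_) hbm (fun j => ?_)
    (fun j φ hφ => ?_) (fun φ hφ => ?_)
  · refine Integrable.of_bound ((hm j).comp_measurable (by fun_prop)).aestronglyMeasurable
      (max C 0 * (eLpNorm η 2 volume).toReal) ?_
    filter_upwards [hbound j] with t ht
    exact abs_mollify_le hη (hu j) (p := (t, x)) ht
  · refine ENNReal.toReal_le_of_le_ofReal (by positivity) ?_
    have h1 := eLpNorm_eval_le (μ := timeMeasure T) (g j) v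
    refine h1.trans ?_
    rw [ENNReal.ofReal_mul (norm_nonneg _)]
    gcongr
    exact (hgC j).trans (ENNReal.ofReal_le_ofReal (le_max_left _ _))
  · simpa only [hpair] using hw j φ hφ v
  · have hη2 := (hη.comp_sub x).memLp volume
    have hφ2 := hφ.memLp (timeMeasure T)
    refine ⟨_, (hweak _ (memLp_two_tensor hφ2 hη2)).congr fun j => ?_⟩
    exact integral_strip_tensor (hu2 j) hφ2 hη2

/-- Spatial mollifications of such a sequence are Cauchy in `L²` of spatially bounded sets. -/
theorem mollify_cauchy (hη : IsTestOn univ η) (hu : ∀ j, StronglyMeasurable (u j))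
    (hu2 : ∀ j, MemLp (u j) 2 (stripMeasure T))
    (hbound : ∀ j, ∀ᵐ t ∂(timeMeasure T), eLpNorm (fun x => u j (t, x)) 2 volume ≤ ENNReal.ofReal C)
    (hg : ∀ j, MemLp (g j) 2 (timeMeasure T))
    (hgC : ∀ j, eLpNorm (g j) 2 (timeMeasure T) ≤ ENNReal.ofReal C)
    (hw : ∀ j, IsWeakTimeDeriv T (fun t x => u j (t, x)) (g j))
    (hweak : WeakL2Tendsto (stripMeasure T) u w) {s : Set (ℝ × ℝ)}
    (hs : stripMeasure T s ≠ ⊤) {ε : ℝ≥0∞} (hε : 0 < ε) :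
    ∃ N, ∀ i ≥ N, ∀ j ≥ N, eLpNorm (fun p => mollify η (u i) p - mollify η (u j) p) 2
      ((stripMeasure T).restrict s) ≤ ε := by
  have hm : ∀ j, StronglyMeasurable (mollify η (u j)) := fun j =>
    stronglyMeasurable_mollify hη.continuous (hu j)
  have hfin : IsFiniteMeasure ((stripMeasure T).restrict s) :=
    isFiniteMeasure_restrict.2 hs
  obtain ⟨L, hL, hlim⟩ := exists_stronglyMeasurable_limit_of_tendsto_ae
    (fun j => (hm j).aestronglyMeasurable) (ae_restrict_of_ae (s := s)
      (ae_exists_tendsto_mollify hη hu hu2 hbound hg hgC hw hweak))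
  have h := tendsto_eLpNorm_two_of_dominated (fun j => (hm j).aestronglyMeasurable)
    hL.aestronglyMeasurable (memLp_const (max C 0 * (eLpNorm η 2 volume).toReal))
    (fun j => ae_restrict_of_ae (by
      filter_upwards [Measure.quasiMeasurePreserving_fst.ae (hbound j)] with p hp
      exact abs_mollify_le hη (hu j) hp)) hlim
  have hε2 : 0 < ε / 2 := ENNReal.half_pos hε.ne'
  obtain ⟨N, hN⟩ := eventually_atTop.1 (h.eventually (ge_mem_nhds hε2))
  refine ⟨N, fun i hi j hj => ?_⟩
  have e : (fun p => mollify η (u i) p - mollify η (u j) p) =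
      (fun p => mollify η (u i) p - L p) - fun p => mollify η (u j) p - L p := by
    ext p
    simp
  rw [e]
  refine (eLpNorm_sub_le ((hm i).sub hL).aestronglyMeasurable
    ((hm j).sub hL).aestronglyMeasurable (by norm_num)).trans ?_
  rw [← ENNReal.add_halves ε]
  exact add_le_add (hN i hi) (hN j hj)

end MollifiedConvergence

/-! ### Strong convergence on sets of finite measure -/

section StrongConvergence

variable {ρ : ℝ → ℝ}

/-- The rescaled kernel `ρₙ`, normalized to have integral one. -/
noncomputable def normalizedKernel (ρ : ℝ → ℝ) (n : ℕ) (x : ℝ) : ℝ :=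
  (∫ y, ρ y)⁻¹ * rescaledKernel ρ n x

theorem isTestOn_normalizedKernel (hρ : ContDiff ℝ ∞ ρ) (hc : HasCompactSupport ρ) {n : ℕ}
    (hn : 1 ≤ n) : IsTestOn univ (normalizedKernel ρ n) := by
  have hn' : (n : ℝ) ≠ 0 := by positivity
  refine ⟨?_, ?_, subset_univ _⟩
  · unfold normalizedKernel rescaledKernel
    fun_prop
  · have h : HasCompactSupport fun x => ρ (n * x) :=
      hc.comp_homeomorph (Homeomorph.mulLeft₀ (n : ℝ) hn')
    unfold normalizedKernel rescaledKernel
    exact (h.mul_left (f := fun _ => (n : ℝ))).mul_left (f := fun _ => (∫ y, ρ y)⁻¹)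

theorem integral_pos_of_ne_zero (hρ : Continuous ρ) (hc : HasCompactSupport ρ)
    (h0 : ∀ x, 0 ≤ ρ x) (hne : ρ ≠ 0) : 0 < ∫ x, ρ x := by
  obtain ⟨x, hx⟩ := Function.ne_iff.1 hne
  exact hρ.integral_pos_of_hasCompactSupport_nonneg_nonzero hc h0 hx

theorem integral_normalizedKernel (hI : 0 < ∫ x, ρ x) {n : ℕ} (hn : 1 ≤ n) :
    ∫ x, normalizedKernel ρ n x = 1 := by
  have hn' : (0 : ℝ) < n := by positivity
  unfold normalizedKernel rescaledKernel
  rw [integral_const_mul, integral_const_mul, Measure.integral_comp_mul_left, smul_eq_mul,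
    abs_of_pos (inv_pos.2 hn')]
  field_simp

variable {T C : ℝ} {u : ℕ → ℝ × ℝ → ℝ} {g : ℕ → ℝ → SobolevHneg1} {w : ℝ × ℝ → ℝ} {K : ℝ≥0∞}

/-- At a fine enough scale, mollification is uniformly close to the identity along a sequence with
bounded nonlocal energies. -/
theorem exists_scale_eLpNorm_sub_mollify_le (hρ : ContDiff ℝ ∞ ρ) (hc : HasCompactSupport ρ)
    (h0 : ∀ x, 0 ≤ ρ x) (hne : ρ ≠ 0) (hu : ∀ j, StronglyMeasurable (u j))
    (hu2 : ∀ j, MemLp (u j) 2 (stripMeasure T)) (hKtop : K ≠ ⊤)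
    (hK : ∀ m j, m ≤ j → 4 ^ m * ∫⁻ w, ENNReal.ofReal (rescaledKernel ρ (2 ^ m) w) *
      shiftNorm T (u j) w ^ 2 ≤ K) {ε : ℝ≥0∞} (hε : 0 < ε) :
    ∃ m, ∀ j ≥ m, eLpNorm (fun p => u j p - mollify (normalizedKernel ρ (2 ^ m)) (u j) p) 2
      (stripMeasure T) ≤ ε := by
  have hI := integral_pos_of_ne_zero hρ.continuous hc h0 hne
  set c := ENNReal.ofReal (∫ y, ρ y)⁻¹ with hcdef
  have hlim : Tendsto (fun m : ℕ => c * K * (1 / 4 : ℝ≥0∞) ^ m) atTop (𝓝 0) := by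
    have h1 : Tendsto (fun m : ℕ => (1 / 4 : ℝ≥0∞) ^ m) atTop (𝓝 0) :=
      ENNReal.tendsto_pow_atTop_nhds_zero_of_lt_one (by
        rw [ENNReal.div_lt_iff (by simp) (by simp)]; norm_num)
    simpa using ENNReal.Tendsto.const_mul h1
      (Or.inr (ENNReal.mul_ne_top ENNReal.ofReal_ne_top hKtop))
  -- The threshold is ε² because the Jensen estimate bounds the square of the norm, by c K 4^(-m).
  obtain ⟨m, hm⟩ := (hlim.eventually (ge_mem_nhds (pos_iff_ne_zero.2 (pow_ne_zero 2 hε.ne')))).exists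
  refine ⟨m, fun j hj => ?_⟩
  have hη := isTestOn_normalizedKernel hρ hc (Nat.one_le_two_pow (n := m))
  have h1 := eLpNorm_sub_mollify_sq_le hη.continuous hη.compact
    (fun x => mul_nonneg (inv_nonneg.2 hI.le) (mul_nonneg (Nat.cast_nonneg _) (h0 _)))
    (integral_normalizedKernel hI Nat.one_le_two_pow) (hu j) (hu2 j)
  have h2 : ∫⁻ w, ENNReal.ofReal (normalizedKernel ρ (2 ^ m) w) * shiftNorm T (u j) w ^ 2 =
      c * ∫⁻ w, ENNReal.ofReal (rescaledKernel ρ (2 ^ m) w) * shiftNorm T (u j) w ^ 2 := by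
    rw [← lintegral_const_mul' _ _ ENNReal.ofReal_ne_top]
    refine lintegral_congr fun w => ?_
    rw [normalizedKernel, ENNReal.ofReal_mul (inv_nonneg.2 hI.le), mul_assoc]
  have h3 : ∫⁻ w, ENNReal.ofReal (rescaledKernel ρ (2 ^ m) w) * shiftNorm T (u j) w ^ 2 ≤
      K * (1 / 4) ^ m := by
    rw [one_div, ← ENNReal.inv_pow, ← div_eq_mul_inv,
      ENNReal.le_div_iff_mul_le (Or.inl (by simp)) (Or.inl (by simp)), mul_comm]
    exact hK m j hj
  rw [h2] at h1
  have h4 : c * ∫⁻ w, ENNReal.ofReal (rescaledKernel ρ (2 ^ m) w) * shiftNorm T (u j) w ^ 2 ≤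
      c * K * (1 / 4) ^ m := by
    rw [mul_assoc]
    gcongr
  exact (ENNReal.pow_le_pow_left_iff two_ne_zero).1 (h1.trans (h4.trans hm))

/-- **Compactness**: a weakly convergent sequence with bounded nonlocal energies and bounded time
derivatives converges strongly in `L²` of sets of finite measure. -/
theorem tendsto_eLpNorm_restrict_of_energy (hρ : ContDiff ℝ ∞ ρ) (hc : HasCompactSupport ρ)
    (h0 : ∀ x, 0 ≤ ρ x) (hne : ρ ≠ 0) (hu : ∀ j, StronglyMeasurable (u j))
    (hu2 : ∀ j, MemLp (u j) 2 (stripMeasure T)) (hKtop : K ≠ ⊤)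
    (hK : ∀ m j, m ≤ j → 4 ^ m * ∫⁻ w, ENNReal.ofReal (rescaledKernel ρ (2 ^ m) w) *
      shiftNorm T (u j) w ^ 2 ≤ K)
    (hbound : ∀ j, ∀ᵐ t ∂(timeMeasure T), eLpNorm (fun x => u j (t, x)) 2 volume ≤ ENNReal.ofReal C)
    (hg : ∀ j, MemLp (g j) 2 (timeMeasure T))
    (hgC : ∀ j, eLpNorm (g j) 2 (timeMeasure T) ≤ ENNReal.ofReal C)
    (hder : ∀ j, IsWeakTimeDeriv T (fun t x => u j (t, x)) (g j)) (hw2 : MemLp w 2 (stripMeasure T))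
    (hweak : WeakL2Tendsto (stripMeasure T) u w) {s : Set (ℝ × ℝ)} (hs : MeasurableSet s)
    (hsfin : stripMeasure T s ≠ ⊤) :
    Tendsto (fun j => eLpNorm (fun p => u j p - w p) 2 ((stripMeasure T).restrict s))
      atTop (𝓝 0) := by
  refine hweak.tendsto_eLpNorm_restrict hu2 hw2 hs fun ε hε => ?_
  have hδ : 0 < ENNReal.ofReal (ε / 3) := ENNReal.ofReal_pos.2 (by positivity)
  obtain ⟨m, hm⟩ := exists_scale_eLpNorm_sub_mollify_le hρ hc h0 hne hu hu2 hKtop hK hδ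
  have hη := isTestOn_normalizedKernel hρ hc (Nat.one_le_two_pow (n := m))
  obtain ⟨N, hN⟩ := mollify_cauchy hη hu hu2 hbound hg hgC hder hweak hsfin hδ
  -- The scale m is fixed before the indices grow; indices must be at least m for the mollification
  -- estimate and at least N for the Cauchy estimate.
  refine ⟨max m N, fun i hi j hj => ?_⟩
  set v := fun j => mollify (normalizedKernel ρ (2 ^ m)) (u j) with hv
  have hvm : ∀ j, StronglyMeasurable (v j) := fun j =>
    stronglyMeasurable_mollify hη.continuous (hu j)
  have hm' : ∀ j ≥ m, eLpNorm (fun p => u j p - v j p) 2 ((stripMeasure T).restrict s) ≤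
      ENNReal.ofReal (ε / 3) := fun j hj =>
    (eLpNorm_mono_measure _ Measure.restrict_le_self).trans (hm j hj)
  have e : (fun p => u i p - u j p) = ((fun p => u i p - v i p) + fun p => v i p - v j p) -
      fun p => u j p - v j p := by
    ext p
    simp
  have hmeas : ∀ i, AEStronglyMeasurable (fun p => u i p - v i p) ((stripMeasure T).restrict s) :=
    fun i => ((hu i).sub (hvm i)).aestronglyMeasurable
  have hmeas' : AEStronglyMeasurable (fun p => v i p - v j p) ((stripMeasure T).restrict s) :=
    ((hvm i).sub (hvm j)).aestronglyMeasurable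
  refine ENNReal.toReal_le_of_le_ofReal hε.le ?_
  rw [e]
  refine (eLpNorm_sub_le ((hmeas i).add hmeas') (hmeas j) (by norm_num)).trans ?_
  refine (add_le_add_left (eLpNorm_add_le (hmeas i) hmeas' (by norm_num)) _).trans ?_
  have h1 := hm' i ((le_max_left _ _).trans hi)
  have h2 := hm' j ((le_max_left _ _).trans hj)
  have h3 := hN i ((le_max_right _ _).trans hi) j ((le_max_right _ _).trans hj)
  refine (add_le_add (add_le_add h1 h3) h2).trans ?_
  rw [← ENNReal.ofReal_add (by positivity) (by positivity),
    ← ENNReal.ofReal_add (by positivity) (by positivity)]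
  exact ENNReal.ofReal_le_ofReal (by linarith)

end StrongConvergence

/-! ### Difference quotients and the spatial derivative of the limit -/

section DifferenceQuotients

variable {T : ℝ}

/-- Along a subsequence, the dyadic difference quotients for one fixed direction `z ≠ 0` are
bounded. -/
theorem exists_direction_bounded {ρ : ℝ → ℝ} (hρ : Continuous ρ) (h0 : ∀ x, 0 ≤ ρ x) (hne : ρ ≠ 0)
    {u : ℕ → ℝ × ℝ → ℝ} (hu : ∀ j, StronglyMeasurable (u j)) {K : ℝ≥0∞} (hKtop : K ≠ ⊤)
    (hK : ∀ j, 4 ^ j * ∫⁻ w, ENNReal.ofReal (rescaledKernel ρ (2 ^ j) w) *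
      shiftNorm T (u j) w ^ 2 ≤ K) :
    ∃ z : ℝ, z ≠ 0 ∧ ∃ C : ℝ≥0∞, C ≠ ⊤ ∧ ∃ φ : ℕ → ℕ, StrictMono φ ∧
      ∀ i, 4 ^ φ i * shiftNorm T (u (φ i)) (z / 2 ^ φ i) ^ 2 ≤ C := by
  set Q : ℕ → ℝ → ℝ≥0∞ := fun j z => 4 ^ j * shiftNorm T (u j) (z / 2 ^ j) ^ 2 with hQ
  have hQm : ∀ j, Measurable (Q j) := fun j => by
    have := measurable_shiftNorm_sq (T := T) (hu j)
    exact (this.comp (by fun_prop : Measurable fun z : ℝ => z / 2 ^ j)).const_mul _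
  have hρm : Measurable fun z => ENNReal.ofReal (ρ z) := hρ.measurable.ennreal_ofReal
  have hKQ : ∀ j, ∫⁻ z, ENNReal.ofReal (ρ z) * Q j z ≤ K := fun j => by
    refine le_trans (le_of_eq ?_) (hK j)
    rw [lintegral_rescaledKernel_mul hρ.measurable Nat.one_le_two_pow
      (measurable_shiftNorm_sq (hu j)), ← lintegral_const_mul' _ _ (by simp)]
    refine lintegral_congr fun z => ?_
    simp only [hQ]
    push_cast
    ring
  -- The energies bound only averages over z. Fatou makes the liminf finite for almost every z; the
  -- support of `ρ` is open and nonempty, hence not null, so it contains such a z ≠ 0.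
  have hfatou : ∫⁻ z, liminf (fun j => ENNReal.ofReal (ρ z) * Q j z) atTop ≤ K := by
    refine (lintegral_liminf_le fun j => hρm.mul (hQm j)).trans ?_
    exact (liminf_le_liminf (.of_forall hKQ)).trans (by simp)
  have hae : ∀ᵐ z : ℝ, liminf (fun j => ENNReal.ofReal (ρ z) * Q j z) atTop < ⊤ :=
    ae_lt_top (Measurable.liminf fun j => hρm.mul (hQm j)) (hfatou.trans_lt hKtop.lt_top).ne
  have hopen : IsOpen (Function.support ρ) := hρ.isOpen_support
  have hsupp : (Function.support ρ).Nonempty := Function.support_nonempty_iff.2 hne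
  have hpos : volume (Function.support ρ) ≠ 0 := (hopen.measure_pos volume hsupp).ne'
  have hz0 : ∀ᵐ z : ℝ, z ≠ 0 := by
    simp [ae_iff, measure_singleton]
  obtain ⟨z, hzρ, hz1, hz⟩ : ∃ z, z ∈ Function.support ρ ∧
      liminf (fun j => ENNReal.ofReal (ρ z) * Q j z) atTop < ⊤ ∧ z ≠ 0 := by
    by_contra! hcon
    refine hpos (measure_mono_null ?_ (ae_iff.1 (hae.and hz0)))
    intro z hz hz'
    exact hz'.2 (hcon z hz hz'.1)
  have hρz : 0 < ρ z := lt_of_le_of_ne (h0 z) (Ne.symm hzρ)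
  obtain ⟨C, hC1, hC2⟩ := exists_between hz1
  have hfreq : ∃ᶠ j in atTop, ENNReal.ofReal (ρ z) * Q j z < C := frequently_lt_of_liminf_lt (by isBoundedDefault) hC1
  obtain ⟨φ, hφ, hφC⟩ := extraction_of_frequently_atTop hfreq
  refine ⟨z, hz, C / ENNReal.ofReal (ρ z),
    (ENNReal.div_lt_top hC2.ne (ENNReal.ofReal_pos.2 hρz).ne').ne, φ, hφ, fun i => ?_⟩
  rw [ENNReal.le_div_iff_mul_le (Or.inl (ENNReal.ofReal_pos.2 hρz).ne')
    (Or.inl ENNReal.ofReal_ne_top), mul_comm]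
  exact (hφC i).le

/-- The dyadic difference quotient of `β` in direction `-z`. -/
noncomputable def dyadicQuotient (β : ℝ → ℝ) (z : ℝ) (n : ℕ) (x : ℝ) : ℝ :=
  2 ^ n * (β (x - z / 2 ^ n) - β x)

theorem tendsto_dyadicQuotient {β : ℝ → ℝ} (hβ : IsTestOn univ β) {z : ℝ} (hz : z ≠ 0) (x : ℝ) :
    Tendsto (fun n => dyadicQuotient β z n x) atTop (𝓝 (-z * deriv β x)) := by
  have hd : HasDerivAt β (deriv β x) x := (hβ.smooth.differentiable (by simp) x).hasDerivAt
  -- With h = -z/2^n the dyadic quotient is -z times the slope of `β` between x and x + h.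
  have hh : Tendsto (fun n : ℕ => -z / 2 ^ n) atTop (𝓝[≠] 0) := by
    refine tendsto_nhdsWithin_iff.2 ⟨?_, .of_forall fun n => by simp [hz]⟩
    exact tendsto_const_nhds.div_atTop (tendsto_pow_atTop_atTop_of_one_lt one_lt_two)
  have h := ((hasDerivAt_iff_tendsto_slope_zero.1 hd).comp hh).const_mul (-z)
  refine h.congr fun n => ?_
  simp only [Function.comp, smul_eq_mul, dyadicQuotient, neg_div, ← sub_eq_add_neg]
  field_simp

/-- A Lipschitz constant L of `β` bounds the quotients by L|z|, and all shifts are at most |z|, so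
the supports stay in one bounded interval. This upgrades pointwise convergence of the quotients to
convergence in L². -/
theorem exists_dominating_dyadicQuotient {β : ℝ → ℝ} (hβ : IsTestOn univ β) (z : ℝ) :
    ∃ D : ℝ → ℝ, MemLp D 2 (volume : Measure ℝ) ∧ ∀ n x, |dyadicQuotient β z n x| ≤ D x := by
  obtain ⟨L, hL⟩ := ContDiff.lipschitzWith_of_hasCompactSupport hβ.compact hβ.smooth (by simp)
  obtain ⟨R, hR⟩ := hβ.compact.isBounded.subset_closedBall 0
  have hzero : ∀ x, R < |x| → β x = 0 := fun x hx => by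
    by_contra h
    have := hR (subset_tsupport _ h)
    rw [mem_closedBall_zero_iff, Real.norm_eq_abs] at this
    linarith
  refine ⟨(Icc (-(R + |z|)) (R + |z|)).indicator fun _ => L * |z|,
    memLp_indicator_const 2 measurableSet_Icc _ (Or.inr (by simp)), fun n x => ?_⟩
  have hn : (1 : ℝ) ≤ 2 ^ n := one_le_pow₀ (by norm_num)
  have hn0 : (0 : ℝ) < 2 ^ n := by positivity
  have hle : |z / 2 ^ n| ≤ |z| := by
    rw [abs_div, abs_of_pos hn0]
    exact div_le_self (abs_nonneg _) hn
  by_cases hx : x ∈ Icc (-(R + |z|)) (R + |z|)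
  · rw [indicator_of_mem hx, dyadicQuotient, abs_mul, abs_of_pos hn0]
    have h := hL.dist_le_mul (x - z / 2 ^ n) x
    rw [Real.dist_eq, Real.dist_eq, sub_sub_cancel_left, abs_neg, abs_div, abs_of_pos hn0] at h
    calc (2 : ℝ) ^ n * |β (x - z / 2 ^ n) - β x| ≤ 2 ^ n * (L * (|z| / 2 ^ n)) := by gcongr
      _ = L * |z| := by field_simp
  · rw [indicator_of_notMem hx]
    have hx' : R + |z| < |x| := by
      by_contra h
      exact hx (abs_le.1 (not_lt.1 h))
    have h1 : R < |x - z / 2 ^ n| := by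
      have := abs_sub_abs_le_abs_sub x (z / 2 ^ n)
      linarith
    rw [dyadicQuotient, hzero x (by linarith [abs_nonneg z]), hzero _ h1]
    simp

/-- If the dyadic difference quotients in a direction `z ≠ 0` are bounded along a weakly convergent
sequence, the weak limit has a weak spatial derivative in `L²`. -/
theorem exists_weak_space_deriv {u : ℕ → ℝ × ℝ → ℝ} {w : ℝ × ℝ → ℝ} {ψ : ℕ → ℕ}
    (hψ : StrictMono ψ)
    (hu2 : ∀ j, MemLp (u j) 2 (stripMeasure T)) {B : ℝ}
    (hB : ∀ j, (eLpNorm (u j) 2 (stripMeasure T)).toReal ≤ B)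
    (hweak : WeakL2Tendsto (stripMeasure T) u w) {z : ℝ} (hz : z ≠ 0) {C : ℝ≥0∞} (hC : C ≠ ⊤)
    (hQ : ∀ j, 4 ^ ψ j * shiftNorm T (u j) (z / 2 ^ ψ j) ^ 2 ≤ C) :
    ∃ v : ℝ × ℝ → ℝ, StronglyMeasurable v ∧ MemLp v 2 (stripMeasure T) ∧
      ∀ α β : ℝ → ℝ, MemLp α 2 (timeMeasure T) → IsTestOn univ β →
        ∫ p, w p * (α p.1 * deriv β p.2) ∂(stripMeasure T) =
          -∫ p, v p * (α p.1 * β p.2) ∂(stripMeasure T) := by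
  set q : ℕ → ℝ × ℝ → ℝ := fun j p => 2 ^ ψ j * (u j (p.1, p.2 + z / 2 ^ ψ j) - u j p) with hq
  have hshift : ∀ j, MemLp (fun p : ℝ × ℝ => u j (p.1, p.2 + z / 2 ^ ψ j)) 2 (stripMeasure T) :=
    fun j => (hu2 j).comp_measurePreserving (measurePreserving_shift T _)
  have hq2 : ∀ j, MemLp (q j) 2 (stripMeasure T) := fun j =>
    ((hshift j).sub (hu2 j)).const_mul _
  have hqC : ∀ j, eLpNorm (q j) 2 (stripMeasure T) ^ 2 ≤ C := fun j => by
    refine le_trans (le_of_eq ?_) (hQ j)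
    rw [hq, eLpNorm_two_sq, shiftNorm, eLpNorm_two_sq, ← lintegral_const_mul' _ _ (by simp)]
    refine lintegral_congr fun p => ?_
    rw [enorm_mul, mul_pow, Real.enorm_of_nonneg (by positivity), ← ENNReal.ofReal_pow (by positivity),
      ← pow_mul, mul_comm (ψ j) 2, pow_mul, ENNReal.ofReal_pow (by positivity)]
    norm_num
  have hqB : ∀ j, (eLpNorm (q j) 2 (stripMeasure T)).toReal ≤ √C.toReal := fun j => by
    refine Real.le_sqrt_of_sq_le ?_
    rw [← ENNReal.toReal_pow]
    exact ENNReal.toReal_mono hC (hqC j)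
  obtain ⟨φ, hφ, G, hGm, hG2, hG⟩ := exists_subseq_weakL2Tendsto hq2 hqB
  -- The quotients `q j` approximate z ∂ₓw, whence the factor z⁻¹.
  refine ⟨fun p => z⁻¹ * G p, hGm.const_mul _, hG2.const_mul _, fun α β hα hβ => ?_⟩
  have hβ2 := hβ.memLp volume
  have hk : ∀ n, MemLp (dyadicQuotient β z n) 2 (volume : Measure ℝ) := fun n =>
    ((((hβ.comp_sub (z / 2 ^ n)).memLp volume).sub hβ2).const_mul _)
  have hk₀ : MemLp (fun x => -z * deriv β x) 2 (volume : Measure ℝ) :=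
    (hβ.deriv.memLp volume).const_mul _
  obtain ⟨D, hD, hDle⟩ := exists_dominating_dyadicQuotient hβ z
  -- The functions `u j` converge only weakly, so the test side of the pairing must converge
  -- strongly.
  have hstrong : Tendsto (fun j => eLpNorm (fun p : ℝ × ℝ =>
      α p.1 * dyadicQuotient β z (ψ (φ j)) p.2 - α p.1 * (-z * deriv β p.2)) 2 (stripMeasure T))
      atTop (𝓝 0) := by
    refine tendsto_eLpNorm_two_of_dominated (fun j => (memLp_two_tensor hα (hk _)).1)
      (memLp_two_tensor hα hk₀).1 (memLp_two_tensor (α := fun t => |α t|) hα.norm hD)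
      (fun j => .of_forall fun p => ?_) (.of_forall fun p => ?_)
    · rw [abs_mul]
      exact mul_le_mul_of_nonneg_left (hDle _ _) (abs_nonneg _)
    · exact ((tendsto_dyadicQuotient hβ hz p.2).comp
        (hψ.comp hφ).tendsto_atTop).const_mul (α p.1)
  have hlim := (hweak.comp hφ).tendsto_integral_mul (fun j => hu2 _) (fun j => hB _)
    (fun j => memLp_two_tensor hα (hk (ψ (φ j)))) (memLp_two_tensor hα hk₀) hstrong
  have hlim' := hG _ (memLp_two_tensor hα hβ2)
  -- Discrete integration by parts: translation invariance moves the quotient onto `β` and reverses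
  -- the direction of the shift.
  have hparts : ∀ j, ∫ p, q j p * (α p.1 * β p.2) ∂(stripMeasure T) =
      ∫ p, u j p * (α p.1 * dyadicQuotient β z (ψ j) p.2) ∂(stripMeasure T) := by
    intro j
    set h := z / 2 ^ ψ j with hh
    have hβh := (hβ.comp_sub h).memLp volume
    have e1 : ∫ p, u j (p.1, p.2 + h) * (α p.1 * β p.2) ∂(stripMeasure T) =
        ∫ p, u j p * (α p.1 * β (p.2 - h)) ∂(stripMeasure T) := by
      have hmp := measurePreserving_shift T h
      conv_rhs => rw [← hmp.map_eq]
      rw [integral_map hmp.aemeasurable]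
      · simp only [add_sub_cancel_right]
      · rw [hmp.map_eq]
        exact (MemLp.integrable_fun_mul (hu2 j) (memLp_two_tensor hα hβh)).1
    have e2 := integral_sub_mul_of_memLp_two (hshift j) (hu2 j) (memLp_two_tensor hα hβ2)
    have e3 := integral_sub_mul_of_memLp_two (memLp_two_tensor hα hβh) (memLp_two_tensor hα hβ2)
      (hu2 j)
    calc ∫ p, q j p * (α p.1 * β p.2) ∂(stripMeasure T)
        = 2 ^ ψ j * ∫ p, (u j (p.1, p.2 + h) - u j p) * (α p.1 * β p.2) ∂(stripMeasure T) := by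
          rw [← integral_const_mul]
          simp only [hq, mul_assoc, hh]
      _ = 2 ^ ψ j * ∫ p, (α p.1 * β (p.2 - h) - α p.1 * β p.2) * u j p ∂(stripMeasure T) := by
          rw [e2, e3, e1]
          simp only [mul_comm (u j _)]
      _ = _ := by
          rw [← integral_const_mul]
          refine integral_congr_ae (.of_forall fun p => ?_)
          simp only [dyadicQuotient, hh]
          ring
  have huniq := tendsto_nhds_unique hlim' (hlim.congr fun j => (hparts (φ j)).symm)
  have e4 : ∫ p, w p * (α p.1 * (-z * deriv β p.2)) ∂(stripMeasure T) =
      -z * ∫ p, w p * (α p.1 * deriv β p.2) ∂(stripMeasure T) := by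
    rw [← integral_const_mul]
    refine integral_congr_ae (.of_forall fun p => ?_)
    simp only
    ring
  rw [e4] at huniq
  simp only [mul_assoc]
  rw [integral_const_mul, huniq]
  field_simp

end DifferenceQuotients

/-! ### Time slices as a measurable map into L²(ℝ) -/

section Sections

/-- A map into a separable metric space whose distances to all points are measurable is
measurable. -/
theorem measurable_of_measurable_dist {α X : Type*} [MeasurableSpace α] [PseudoMetricSpace X]
    [SecondCountableTopology X] [MeasurableSpace X] [BorelSpace X] {F : α → X}
    (h : ∀ x, Measurable fun t => dist (F t) x) : Measurable F := by
  refine measurable_of_isOpen fun U hU => ?_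
  have hr : ∀ x : U, ∃ r > 0, Metric.ball (x : X) r ⊆ U := fun x =>
    Metric.isOpen_iff.1 hU x x.2
  choose r hr0 hrU using hr
  -- Lindelöf: countably many balls cover the open set, and preimages of balls are measurable by
  -- hypothesis.
  obtain ⟨S, hS, hSU⟩ := TopologicalSpace.isOpen_iUnion_countable
    (fun x : U => Metric.ball (x : X) (r x)) fun x => Metric.isOpen_ball
  have hUeq : U = ⋃ x ∈ S, Metric.ball (x : X) (r x) := by
    rw [hSU]
    refine Subset.antisymm (fun x hx => mem_iUnion.2 ⟨⟨x, hx⟩, Metric.mem_ball_self (hr0 _)⟩)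
      (iUnion_subset hrU)
  rw [hUeq, preimage_iUnion₂]
  exact MeasurableSet.biUnion hS fun x _ => measurableSet_lt (h x) measurable_const

/-- An almost everywhere submodule-valued square integrable function lifts to the submodule. -/
theorem exists_memLp_lift_submodule {α E : Type*} [MeasurableSpace α] {μ : Measure α}
    [NormedAddCommGroup E] [NormedSpace ℝ E] (S : Submodule ℝ E) {F : α → E} (hF : MemLp F 2 μ)
    (h : ∀ᵐ t ∂μ, F t ∈ S) : ∃ G : α → S, MemLp G 2 μ ∧ ∀ᵐ t ∂μ, (G t : E) = F t := by
  classical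
  let G : α → S := fun t => if ht : F t ∈ S then ⟨F t, ht⟩ else 0
  have hG : ∀ᵐ t ∂μ, (G t : E) = F t := by
    filter_upwards [h] with t ht
    simp [G, ht]
  have hGm : AEStronglyMeasurable G μ := by
    rw [← Topology.IsEmbedding.subtypeVal.aestronglyMeasurable_comp_iff]
    exact hF.1.congr (hG.mono fun t ht => ht.symm)
  refine ⟨G, hF.mono hGm ?_, hG⟩
  filter_upwards [hG] with t ht
  rw [← ht]
  exact le_rfl

variable {T : ℝ} {u : ℝ × ℝ → ℝ}

open Classical in
/-- The section `u(t, ·)` as an element of `L²(ℝ)` (zero if it is not square integrable). -/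
noncomputable def sectionL2 (u : ℝ × ℝ → ℝ) (t : ℝ) : Lp ℝ 2 (volume : Measure ℝ) :=
  if h : MemLp (fun x => u (t, x)) 2 volume then h.toLp _ else 0

theorem coeFn_sectionL2 {t : ℝ} (h : MemLp (fun x => u (t, x)) 2 volume) :
    sectionL2 u t =ᵐ[volume] fun x => u (t, x) := by
  rw [sectionL2, dif_pos h]
  exact h.coeFn_toLp

/-- As L²(ℝ) is separable, it suffices that the distance to each fixed `y` is measurable in t. On
square integrable slices it is a partial integral, measurable by Tonelli; elsewhere it is ‖y‖. -/
theorem stronglyMeasurable_sectionL2 (hu : StronglyMeasurable u) :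
    StronglyMeasurable (sectionL2 u) := by
  have : Fact ((2 : ℝ≥0∞) ≠ ⊤) := ⟨by simp⟩
  have hum := hu.measurable
  borelize ↥(Lp ℝ 2 (volume : Measure ℝ))
  refine Measurable.stronglyMeasurable (measurable_of_measurable_dist fun y => ?_)
  have hym := (Lp.stronglyMeasurable y).measurable
  have hsec : ∀ t, AEStronglyMeasurable (fun x => u (t, x)) volume := fun t =>
    (hu.comp_measurable (by fun_prop)).aestronglyMeasurable
  have hsq : ∀ k : ℝ → ℝ, Measurable k →
      Measurable fun t => eLpNorm (fun x => u (t, x) - k x) 2 volume := by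
    intro k hk
    have h1 : Measurable fun t => eLpNorm (fun x => u (t, x) - k x) 2 volume ^ 2 := by
      simp only [eLpNorm_two_sq]
      exact Measurable.lintegral_prod_right' (f := fun p : ℝ × ℝ => ‖u p - k p.2‖ₑ ^ 2)
        (by fun_prop)
    have h2 := h1.pow_const (1 / 2 : ℝ)
    simp only [← ENNReal.rpow_natCast, ← ENNReal.rpow_mul] at h2
    norm_num at h2
    exact h2
  have hA : MeasurableSet {t | MemLp (fun x => u (t, x)) 2 volume} := by
    have e : {t | MemLp (fun x => u (t, x)) 2 volume} =
        {t | eLpNorm (fun x => u (t, x) - (fun _ => (0 : ℝ)) x) 2 volume < ⊤} := by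
      ext t
      simp only [sub_zero, mem_ofPred_eq]
      exact ⟨fun h => h.2, fun h => ⟨hsec t, h⟩⟩
    rw [e]
    exact measurableSet_lt (hsq _ measurable_const) measurable_const
  have hd : ∀ t, dist (sectionL2 u t) y =
      {t | MemLp (fun x => u (t, x)) 2 volume}.indicator
        (fun t => (eLpNorm (fun x => u (t, x) - y x) 2 volume).toReal) t +
      {t | MemLp (fun x => u (t, x)) 2 volume}ᶜ.indicator (fun _ => ‖y‖) t := by
    intro t
    by_cases h : MemLp (fun x => u (t, x)) 2 volume
    · rw [indicator_of_mem (by exact h), indicator_of_notMem (by simpa using h), add_zero,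
        Lp.dist_def]
      congr 1
      refine eLpNorm_congr_ae ?_
      filter_upwards [coeFn_sectionL2 h] with x hx
      simp [hx]
    · rw [indicator_of_notMem (by exact h), indicator_of_mem (by exact h), zero_add, sectionL2,
        dif_neg h, dist_zero_left]
  simp only [hd]
  exact ((hsq _ hym).ennreal_toReal.indicator hA).add (measurable_const.indicator hA.compl)

theorem memLp_sectionL2 (hu : StronglyMeasurable u) (hu2 : MemLp u 2 (stripMeasure T)) :
    MemLp (sectionL2 u) 2 (timeMeasure T) := by
  have hum := hu.measurable
  refine ⟨(stronglyMeasurable_sectionL2 hu).aestronglyMeasurable, ?_⟩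
  rw [← eLpNorm_norm]
  have h : eLpNorm (fun t => ‖sectionL2 u t‖) 2 (timeMeasure T) ^ 2 =
      eLpNorm u 2 (stripMeasure T) ^ 2 := by
    rw [eLpNorm_two_sq, eLpNorm_two_sq, lintegral_prod _ (by fun_prop)]
    refine lintegral_congr_ae ?_
    filter_upwards [memLp_two_section hu hu2] with t ht
    rw [← eLpNorm_two_sq (fun x => u (t, x)), enorm_norm, sectionL2, dif_pos ht, Lp.enorm_toLp]
  have h' : eLpNorm (fun t => ‖sectionL2 u t‖) 2 (timeMeasure T) ^ 2 < ⊤ := by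
    rw [h]
    exact ENNReal.pow_lt_top hu2.2
  simpa using h'

end Sections

/-! ### The limit belongs to L²((0,T), H¹) -/

section LimitInH1

variable {T : ℝ} {w v : ℝ × ℝ → ℝ}

theorem integrable_section_mul {u : ℝ × ℝ → ℝ} (hu2 : MemLp u 2 (stripMeasure T)) {β : ℝ → ℝ}
    (hβ : MemLp β 2 volume) : Integrable (fun t => ∫ x, u (t, x) * β x) (timeMeasure T) := by
  have h := MemLp.integrable_fun_mul hu2
    (memLp_two_tensor (memLp_const (μ := timeMeasure T) (1 : ℝ)) hβ)
  simpa using h.integral_prod_left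

/-- For each test function, the weak derivative identity on the strip holds on almost all time
slices. -/
theorem ae_section_weak_deriv (hw2 : MemLp w 2 (stripMeasure T)) (hv2 : MemLp v 2 (stripMeasure T))
    (h : ∀ α β : ℝ → ℝ, MemLp α 2 (timeMeasure T) → IsTestOn univ β →
      ∫ p, w p * (α p.1 * deriv β p.2) ∂(stripMeasure T) =
        -∫ p, v p * (α p.1 * β p.2) ∂(stripMeasure T)) {β : ℝ → ℝ} (hβ : IsTestOn univ β) :
    ∀ᵐ t ∂(timeMeasure T), (∫ x, w (t, x) * deriv β x) + ∫ x, v (t, x) * β x = 0 := by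
  have hβ1 := hβ.memLp volume
  have hβ2 := hβ.deriv.memLp volume
  have hi1 := integrable_section_mul hw2 hβ2
  have hi2 := integrable_section_mul hv2 hβ1
  have hint := hi1.add hi2
  rw [timeMeasure, ae_restrict_iff' measurableSet_Ioo]
  refine isOpen_Ioo.ae_eq_zero_of_integral_contDiff_smul_eq_zero
    (IntegrableOn.locallyIntegrableOn hint) fun α hα hαc hαs => ?_
  have hαt : IsTestOn (Ioo 0 T) α := ⟨hα, hαc, hαs⟩
  have hα2 := hαt.memLp (timeMeasure T)
  have hbd : ∀ F : ℝ → ℝ, Integrable F (timeMeasure T) →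
      Integrable (fun t => α t * F t) (timeMeasure T) := by
    intro F hF
    obtain ⟨C, hC⟩ := hα.continuous.bounded_above_of_compact_support hαc
    exact hF.bdd_mul hα.continuous.aestronglyMeasurable (.of_forall hC)
  have e : ∫ t, α t * ((∫ x, w (t, x) * deriv β x) + ∫ x, v (t, x) * β x) ∂(timeMeasure T) = 0 := by
    simp only [mul_add]
    rw [integral_add (hbd _ hi1) (hbd _ hi2), ← integral_strip_tensor hw2 hα2 hβ2,
      ← integral_strip_tensor hv2 hα2 hβ1, h α β hα2 hβ, neg_add_cancel]
  rw [← e, timeMeasure, setIntegral_eq_integral_of_forall_compl_eq_zero]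
  · rfl
  · intro t ht
    rw [show α t = 0 from by_contra fun h' => ht (hαs (subset_tsupport _ h')), zero_mul]

/-- A function on the strip with a weak spatial derivative in `L²` belongs to
`L²((0,T), H¹(ℝ))`. -/
theorem memL2H1_of_weak_deriv (hw : StronglyMeasurable w) (hv : StronglyMeasurable v)
    (hw2 : MemLp w 2 (stripMeasure T)) (hv2 : MemLp v 2 (stripMeasure T))
    (h : ∀ α β : ℝ → ℝ, MemLp α 2 (timeMeasure T) → IsTestOn univ β →
      ∫ p, w p * (α p.1 * deriv β p.2) ∂(stripMeasure T) =
        -∫ p, v p * (α p.1 * β p.2) ∂(stripMeasure T)) :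
    MemL2H1 T fun t x => w (t, x) := by
  have hfact : Fact ((2 : ℝ≥0∞) ≠ ⊤) := ⟨by simp⟩
  let X : Type := Lp ℝ 2 (volume : Measure ℝ)
  -- The null set of times depends on the test function, and there are uncountably many. The pairs
  -- (β', β) lie in a separable space and the identity is continuous in the pair, so a countable
  -- dense set of them is enough.
  let e : {β : ℝ → ℝ // IsTestOn univ β} → X × X := fun β =>
    ((β.2.deriv.memLp volume).toLp _, (β.2.memLp volume).toLp _)
  obtain ⟨D, hDe, hDc, hDd⟩ :=
    (TopologicalSpace.IsSeparable.of_separableSpace (range e)).exists_countable_dense_subset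
  let L : ℝ → X × X → ℝ := fun t d => inner ℝ (sectionL2 w t) d.1 + inner ℝ (sectionL2 v t) d.2
  have hLc : ∀ t, Continuous (L t) := fun t => by
    simp only [L]
    fun_prop
  have hLe : ∀ t, MemLp (fun x => w (t, x)) 2 volume → MemLp (fun x => v (t, x)) 2 volume →
      ∀ β, L t (e β) = (∫ x, w (t, x) * deriv β.1 x) + ∫ x, v (t, x) * β.1 x := by
    intro t h1 h2 β
    simp only [L, e, sectionL2, dif_pos h1, dif_pos h2]
    rw [inner_toLp_eq_integral, inner_toLp_eq_integral]
  have hwt := memLp_two_section hw hw2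
  have hvt := memLp_two_section hv hv2
  have hD : ∀ᵐ t ∂(timeMeasure T), ∀ d ∈ D, L t d = 0 := by
    rw [ae_ball_iff hDc]
    intro d hd
    obtain ⟨β, rfl⟩ := hDe hd
    filter_upwards [hwt, hvt, ae_section_weak_deriv hw2 hv2 h β.2] with t h1 h2 h3
    rw [hLe t h1 h2, h3]
  have hmem : ∀ᵐ t ∂(timeMeasure T),
      WithLp.toLp 2 (sectionL2 w t, sectionL2 v t) ∈ SobolevH1 := by
    filter_upwards [hwt, hvt, hD] with t h1 h2 h3 φ hφ
    have h4 : L t (e ⟨φ, hφ⟩) = 0 :=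
      closure_minimal (s := D) (t := {d | L t d = 0}) h3 (isClosed_eq (hLc t) continuous_const)
        (hDd (mem_range_self _))
    rw [hLe t h1 h2] at h4
    have h5 : ∫ x, sectionL2 w t x * deriv φ x = ∫ x, w (t, x) * deriv φ x := by
      refine integral_congr_ae ?_
      filter_upwards [coeFn_sectionL2 h1] with x hx
      rw [hx]
    have h6 : ∫ x, sectionL2 v t x * φ x = ∫ x, v (t, x) * φ x := by
      refine integral_congr_ae ?_
      filter_upwards [coeFn_sectionL2 h2] with x hx
      rw [hx]
    change ∫ x, sectionL2 w t x * deriv φ x = -∫ x, sectionL2 v t x * φ x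
    rw [h5, h6]
    exact eq_neg_of_add_eq_zero_left h4
  have hpair : MemLp (fun t => WithLp.toLp 2 (sectionL2 w t, sectionL2 v t)) 2 (timeMeasure T) :=
    memLp_prodLp_iff.2 ⟨memLp_sectionL2 hw hw2, memLp_sectionL2 hv hv2⟩
  obtain ⟨F, hF, hFe⟩ := exists_memLp_lift_submodule SobolevH1 hpair hmem
  refine ⟨F, hF, ?_⟩
  filter_upwards [hFe, hwt] with t ht h1
  have h2 : SobolevH1.toL2 (F t) = sectionL2 w t := by
    rw [SobolevH1.toL2, ht]
    rfl
  rw [h2]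
  exact (coeFn_sectionL2 h1).symm

end LimitInH1

/-! ### Assembling the proof -/

section Assembly

variable {T M : ℝ}

theorem stripMeasure_restrict_eq {K : Set (ℝ × ℝ)} (hK : MeasurableSet K)
    (hKT : K ⊆ Ioo 0 T ×ˢ univ) : (stripMeasure T).restrict K = volume.restrict K := by
  have e : stripMeasure T = (volume : Measure (ℝ × ℝ)).restrict (Ioo 0 T ×ˢ univ) := by
    rw [Measure.volume_eq_prod, ← Measure.prod_restrict, Measure.restrict_univ]
    rfl
  rw [e, Measure.restrict_restrict hK, inter_eq_self_of_subset_left hKT]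

theorem eLpNorm_strip_sq_le {u : ℝ × ℝ → ℝ} (hu : StronglyMeasurable u) {C : ℝ≥0∞}
    (h : ∀ᵐ t ∂(timeMeasure T), eLpNorm (fun x => u (t, x)) 2 volume ≤ C) :
    eLpNorm u 2 (stripMeasure T) ^ 2 ≤ C ^ 2 * timeMeasure T univ := by
  have hum := hu.measurable
  rw [eLpNorm_two_sq, lintegral_prod _ (by fun_prop), ← lintegral_const]
  refine lintegral_mono_ae ?_
  filter_upwards [h] with t ht
  rw [← eLpNorm_two_sq (fun x => u (t, x))]
  gcongr

/-- The weak time derivative only depends on the class of the function. -/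
theorem IsWeakTimeDeriv.congr {f f' : ℝ → ℝ → ℝ} {g : ℝ → SobolevHneg1}
    (h : IsWeakTimeDeriv T f g) (hff' : ∀ᵐ t ∂(timeMeasure T), f t =ᵐ[volume] f' t) :
    IsWeakTimeDeriv T f' g := by
  intro φ hφ v
  rw [← h φ hφ v]
  refine integral_congr_ae ?_
  filter_upwards [hff'] with t ht
  congr 1
  refine integral_congr_ae ?_
  filter_upwards [ht] with x hx
  rw [hx]

end Assembly

theorem proposition3p3
    (ρ : ℝ → ℝ) (hρ_nonneg : ∀ x, 0 ≤ ρ x) (hρ_smooth : ContDiff ℝ ∞ ρ)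
    (hρ_radial : ∀ x, ρ (-x) = ρ x) (hρ_supp : HasCompactSupport ρ) (hρ_ne : ρ ≠ 0)
    (T : ℝ) (hT : 0 < T) (M : ℝ)
    (f : ℕ → ℝ → ℝ → ℝ)
    (hf_meas : ∀ n, 1 ≤ n → MeasurableOnStrip T (f n))
    (hf_bound : ∀ n, 1 ≤ n → normLinftyL2 T (f n) ≤ ENNReal.ofReal M)
    (hf_energy : ∀ n, 1 ≤ n → nonlocalEnergy ρ T n (f n) ≤ ENNReal.ofReal M)
    (hf_deriv : ∀ n, 1 ≤ n → TimeDerivBound T (f n) (ENNReal.ofReal M)) :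
    ∃ f₀ : ℝ → ℝ → ℝ, MeasurableOnStrip T f₀ ∧ MemL2H1 T f₀ ∧
      ∃ φ : ℕ → ℕ, StrictMono φ ∧ TendstoL2loc T (fun k => f (φ k)) f₀ := by

  have hpow : ∀ j : ℕ, 1 ≤ 2 ^ j := fun j => Nat.one_le_two_pow
  -- Only dyadic indices are kept, since doubling compares dyadic scales; strongly measurable
  -- representatives make the slices and shifts measurable.
  let u : ℕ → ℝ × ℝ → ℝ := fun j => (hf_meas (2 ^ j) (hpow j)).mk _
  have hu : ∀ j, StronglyMeasurable (u j) := fun j =>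
    (hf_meas (2 ^ j) (hpow j)).stronglyMeasurable_mk
  have hfu : ∀ j, (fun p : ℝ × ℝ => f (2 ^ j) p.1 p.2) =ᵐ[stripMeasure T] u j := fun j =>
    (hf_meas (2 ^ j) (hpow j)).ae_eq_mk
  have hfu' : ∀ j, ∀ᵐ t ∂(timeMeasure T), f (2 ^ j) t =ᵐ[volume] fun x => u j (t, x) := fun j =>
    Measure.ae_ae_of_ae_prod (hfu j)
  have hbound : ∀ j, ∀ᵐ t ∂(timeMeasure T),
      eLpNorm (fun x => u j (t, x)) 2 volume ≤ ENNReal.ofReal M := by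
    intro j
    filter_upwards [hfu' j, ENNReal.ae_le_essSup (μ := timeMeasure T)
      fun t => eLpNorm (f (2 ^ j) t) 2 volume] with t h1 h2
    rw [← eLpNorm_congr_ae h1]
    exact h2.trans (hf_bound _ (hpow j))
  have hsq := fun j => eLpNorm_strip_sq_le (hu j) (hbound j)
  have hBtop : ENNReal.ofReal M ^ 2 * timeMeasure T univ ≠ ⊤ :=
    ENNReal.mul_ne_top (ENNReal.pow_ne_top ENNReal.ofReal_ne_top) (measure_ne_top _ _)
  have hu2 : ∀ j, MemLp (u j) 2 (stripMeasure T) := fun j =>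
    ⟨(hu j).aestronglyMeasurable, by simpa using (hsq j).trans_lt hBtop.lt_top⟩
  have hB : ∀ j, (eLpNorm (u j) 2 (stripMeasure T)).toReal ≤
      √(ENNReal.ofReal M ^ 2 * timeMeasure T univ).toReal := fun j => by
    refine Real.le_sqrt_of_sq_le ?_
    rw [← ENNReal.toReal_pow]
    exact ENNReal.toReal_mono hBtop (hsq j)
  choose g hg hgder hgM using fun j => hf_deriv (2 ^ j) (hpow j)
  have hder : ∀ j, IsWeakTimeDeriv T (fun t x => u j (t, x)) (g j) := fun j =>
    (hgder j).congr (hfu' j)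
  have hρc : Continuous ρ := hρ_smooth.continuous
  have hK : ∀ j, 4 ^ j * ∫⁻ w, ENNReal.ofReal (rescaledKernel ρ (2 ^ j) w) *
      shiftNorm T (u j) w ^ 2 ≤ ENNReal.ofReal M := fun j => by
    have h := hf_energy (2 ^ j) (hpow j)
    rw [nonlocalEnergy_eq hρc.measurable hρ_nonneg _ (hu j) (hfu j)] at h
    have e : (((2 ^ j : ℕ) : ℝ≥0∞)) ^ 2 = 4 ^ j := by
      push_cast
      rw [← pow_mul, mul_comm, pow_mul]
      norm_num
    rwa [e] at h
  -- The subsequence with bounded quotients is extracted first, so that the weak limit is taken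
  -- along it and inherits the bound.
  obtain ⟨z, hz, C, hC, φ₁, hφ₁, hQ⟩ :=
    exists_direction_bounded hρc hρ_nonneg hρ_ne hu ENNReal.ofReal_ne_top hK
  obtain ⟨φ₂, hφ₂, w, hw, hw2, hweak⟩ :=
    exists_subseq_weakL2Tendsto (fun j => hu2 (φ₁ j)) fun j => hB (φ₁ j)
  have hψ : StrictMono fun k => φ₁ (φ₂ k) := hφ₁.comp hφ₂
  obtain ⟨v, hv, hv2, hwv⟩ := exists_weak_space_deriv hψ (fun k => hu2 (φ₁ (φ₂ k)))
    (fun k => hB (φ₁ (φ₂ k))) hweak hz hC fun k => hQ (φ₂ k)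
  refine ⟨fun t x => w (t, x), hw.aestronglyMeasurable,
    memL2H1_of_weak_deriv hw hv hw2 hv2 hwv, fun k => 2 ^ φ₁ (φ₂ k),
    (pow_right_strictMono₀ (one_lt_two : (1 : ℕ) < 2)).comp hψ, fun K hKc hKT => ?_⟩
  have hKm := hKc.measurableSet
  have hres := stripMeasure_restrict_eq hKm hKT
  have hfin : stripMeasure T K ≠ ⊤ := by
    rw [← Measure.restrict_apply_univ, hres, Measure.restrict_apply_univ]
    exact hKc.measure_lt_top.ne
  have hlim := tendsto_eLpNorm_restrict_of_energy hρ_smooth hρ_supp hρ_nonneg hρ_ne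
    (fun k => hu (φ₁ (φ₂ k))) (fun k => hu2 (φ₁ (φ₂ k))) ENNReal.ofReal_ne_top
    -- The k-th term has dyadic exponent φ₁ (φ₂ k) ≥ k, so its energy is bounded at every scale 2^m
    -- with m ≤ k.
    (fun m k hmk => (lintegral_rescaledKernel_two_pow_mono hρc.measurable (hu (φ₁ (φ₂ k)))
      (hmk.trans (hψ.le_apply))).trans (hK (φ₁ (φ₂ k))))
    (fun k => hbound (φ₁ (φ₂ k))) (fun k => hg (φ₁ (φ₂ k))) (fun k => hgM (φ₁ (φ₂ k)))
    (fun k => hder (φ₁ (φ₂ k))) hw2 hweak hKm hfin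
  rw [hres] at hlim
  refine hlim.congr fun k => eLpNorm_congr_ae ?_
  rw [← hres]
  filter_upwards [ae_restrict_of_ae (hfu (φ₁ (φ₂ k)))] with p hp
  rw [hp]
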